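/- Let $A=C(\mathbb T)$ with standard generator $Z(z)=z$, and let $\mathbb N^\times$ be the multiplicative semigroup of positive integers, ordered by divisibility, so that $m\vee n=\operatorname{lcm}(m,n)$. For $m\in\mathbb N^\times$ put $\alpha_m(f)(z)=f(z^m)$ and $L_m(f)(z)=\frac1m\sum_{w^m=z}f(w)$ for $f\in A$. Let $X_m=\{\xi 1_m:\xi\in A\}$ be the copy of the vector space $A$ with right action $(\xi 1_m)\cdot f=\xi\alpha_m(f)1_m$, left action $f\cdot(\xi 1_m)=(f\xi)1_m$ and $A$-valued inner product $\langle \xi 1_m,\eta 1_m\rangle_m=L_m(\xi^*\eta)$; it is a right Hilbert $A$–$A$-bimodule. Let $X=\bigsqcup_m X_m$ be the product system over $\mathbb N^\times$ with multiplication $(\xi 1_m)(\eta 1_r)=\xi\alpha_m(\eta)1_{mr}$. A Toeplitz representation of $X$ in a $C^*$-algebra $C$ is a family of linear maps $\psi_m:X_m\to C$ such that $\psi_1$ is a $*$-homomorphism on $X_1=A$, $\psi_m(x)\psi_n(y)=\psi_{mn}(xy)$ and $\psi_m(x)^*\psi_m(y)=\psi_1(\langle x,y\rangle_m)$. Let $\theta_{x,y}(\zeta)=x\cdot\langle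 y,\zeta\rangle_m$, let $\mathcal K(X_m)$ be the closed linear span of these operators, and let $\psi^{(m)}:\mathcal K(X_m)\to C$ be the $*$-homomorphism with $\psi^{(m)}(\theta_{x,y})=\psi_m(x)\psi_m(y)^*$. For $m\mid r$ and $S\in\mathcal K(X_m)$ let $i_m^r(S)$ be the operator on $X_r$ with $i_m^r(S)(xy)=(Sx)y$ for $x\in X_m$, $y\in X_{r/m}$. The representation $\psi$ is Nica covariant if $\psi^{(m)}(S)\psi^{(n)}(T)=\psi^{(m\vee n)}\bigl(i_m^{m\vee n}(S)\,i_n^{m\vee n}(T)\bigr)$ for all $m,n$, $S\in\mathcal K(X_m)$ and $T\in\mathcal K(X_n)$. Let $\mathcal T_{\rm cov}(X)$ be the $C^*$-algebra generated by a universal Nica covariant Toeplitz representation $i=(i_m)_m$ of $X$; it is unital with unit $i_1(1)$. **Theorem.** The element $u=i_1(Z)$ is a unitary in $\mathcal T_{\rm cov}(X)$, each $w_m=i_m(1_m)$, $m\in\mathbb N^\times$, is an isometry, and - (B1) $w_{mn}=w_mw_n$ for all $m,n\in\mathbb N^\times$; - (B2) $w_mu=u^mw_m$ for all $m\in\mathbb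 N^\times$; - (B3) $w_p^*w_q=w_qw_p^*$ for distinct primes $p,q$; - (B4) $w_p^*u^kw_p=0$ for every prime $p$ and $1\le k<p$. Moreover, $\mathcal T_{\rm cov}(X)$ is the universal $C^*$-algebra generated by a unitary and isometries satisfying (B1)–(B4): it is generated as a $C^*$-algebra by $u$ and the $w_m$, and for every unital $C^*$-algebra $C$, unitary $U\in C$ and isometries $W_m\in C$ ($m\in\mathbb N^\times$) satisfying (B1)–(B4) there is exactly one unital $*$-homomorphism $\pi:\mathcal T_{\rm cov}(X)\to C$ with $\pi(u)=U$ and $\pi(w_m)=W_m$ for all $m$. -/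

import Mathlib

namespace NicaToeplitz

noncomputable section

open scoped ComplexOrder

/-- The coefficient algebra `A = C(𝕋)`. -/
abbrev A : Type := C(Circle, ℂ)

/-- The standard unitary generator `Z(z) = z` of `C(𝕋)`. -/
def Z : A := ⟨fun z => (z : ℂ), by fun_prop⟩

/-- The endomorphism `α_m(f)(z) = f(z ^ m)` of `C(𝕋)`. -/
def alpha (m : ℕ+) : A →⋆ₐ[ℂ] A :=
  ContinuousMap.compStarAlgHom' ℂ ℂ ⟨fun z : Circle => z ^ (m : ℕ), by fun_prop⟩

theorem alpha_apply (m : ℕ+) (f : A) (z : Circle) : alpha m f z = f (z ^ (m : ℕ)) := rfl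

theorem finite_roots (m : ℕ+) (z : Circle) : {w : Circle | w ^ (m : ℕ) = z}.Finite := by
  have h : ((Polynomial.nthRoots (m : ℕ) (z : ℂ)).toFinset : Set ℂ).Finite :=
    Finset.finite_toSet _
  refine (h.preimage (f := fun w : Circle => (w : ℂ))
    (Circle.coe_injective.injOn)).subset ?_
  intro w hw
  have hw' : w ^ (m : ℕ) = z := hw
  simp [Polynomial.mem_nthRoots m.pos, ← hw']

/-- The finite set of `m`-th roots of `z` in `𝕋`. -/
def roots (m : ℕ+) (z : Circle) : Finset Circle := (finite_roots m z).toFinset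

theorem mem_roots {m : ℕ+} {z w : Circle} : w ∈ roots m z ↔ w ^ (m : ℕ) = z := by
  simp [roots]

theorem card_roots_le (m : ℕ+) (z : Circle) : (roots m z).card ≤ m := by
  have h1 : ((roots m z).image (fun w : Circle => (w : ℂ))) ⊆
      (Polynomial.nthRoots (m : ℕ) (z : ℂ)).toFinset := by
    intro x hx
    obtain ⟨w, hw, rfl⟩ := Finset.mem_image.1 hx
    have hw' := mem_roots.1 hw
    simp [Polynomial.mem_nthRoots m.pos, ← hw']
  calc (roots m z).card = ((roots m z).image (fun w : Circle => (w : ℂ))).card :=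
        (Finset.card_image_of_injective _ Circle.coe_injective).symm
    _ ≤ (Polynomial.nthRoots (m : ℕ) (z : ℂ)).toFinset.card := Finset.card_le_card h1
    _ ≤ _ := (Multiset.toFinset_card_le _).trans (Polynomial.card_nthRoots _ _)

theorem sum_roots_pow (m : ℕ+) (z : Circle) (f : Circle → ℂ) :
    ∑ w ∈ roots m (z ^ (m : ℕ)), f w = ∑ w ∈ roots m 1, f (w * z) := by
  refine (Finset.sum_bij' (fun w _ => w * z) (fun w _ => w * z⁻¹) ?_ ?_ ?_ ?_ ?_).symm
  · intro w hw
    rw [mem_roots] at hw ⊢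
    simp [mul_pow, hw]
  · intro w hw
    rw [mem_roots] at hw ⊢
    simp [mul_pow, hw]
  · simp
  · simp
  · simp

theorem exists_root (m : ℕ+) (z : Circle) : ∃ w : Circle, w ^ (m : ℕ) = z := by
  obtain ⟨t, rfl⟩ := Circle.exp_surjective z
  refine ⟨Circle.exp (t / m), ?_⟩
  rw [← Circle.exp_nsmul]
  congr 1
  have : ((m : ℕ) : ℝ) ≠ 0 := by exact_mod_cast m.ne_zero
  simp
  field_simp

theorem continuous_transfer (m : ℕ+) (f : A) :
    Continuous fun z : Circle => ((m : ℕ) : ℂ)⁻¹ * ∑ w ∈ roots m z, f w := by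
  have hp : Continuous fun z : Circle => z ^ (m : ℕ) := by fun_prop
  have hq : Topology.IsQuotientMap fun z : Circle => z ^ (m : ℕ) :=
    Topology.IsQuotientMap.of_surjective_continuous (exists_root m) hp
  rw [hq.continuous_iff]
  have : (fun z : Circle => ((m : ℕ) : ℂ)⁻¹ * ∑ w ∈ roots m z, f w) ∘
      (fun z : Circle => z ^ (m : ℕ)) =
      fun z => ((m : ℕ) : ℂ)⁻¹ * ∑ w ∈ roots m 1, f (w * z) := by
    funext z
    simp only [Function.comp]
    rw [sum_roots_pow]
  rw [this]
  fun_prop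

/-- The transfer operator `L_m(f)(z) = (1/m) ∑_{w ^ m = z} f(w)`. -/
def transfer (m : ℕ+) : A →ₗ[ℂ] A where
  toFun f := ⟨fun z => ((m : ℕ) : ℂ)⁻¹ * ∑ w ∈ roots m z, f w, continuous_transfer m f⟩
  map_add' f g := by
    ext z
    simp [Finset.sum_add_distrib, mul_add]
  map_smul' c f := by
    ext z
    simp [← Finset.mul_sum]
    ring

theorem transfer_apply (m : ℕ+) (f : A) (z : Circle) :
    transfer m f z = ((m : ℕ) : ℂ)⁻¹ * ∑ w ∈ roots m z, f w := rfl

theorem transfer_mul_alpha (m : ℕ+) (f g : A) :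
    transfer m (f * alpha m g) = transfer m f * g := by
  ext z
  simp only [transfer_apply, ContinuousMap.mul_apply, alpha_apply]
  rw [mul_assoc, Finset.sum_mul]
  congr 1
  refine Finset.sum_congr rfl fun w hw => ?_
  rw [mem_roots.1 hw]

theorem star_transfer (m : ℕ+) (f : A) : star (transfer m f) = transfer m (star f) := by
  ext z
  simp [transfer_apply]

theorem transfer_nonneg (m : ℕ+) (f : A) : 0 ≤ transfer m (star f * f) := by
  intro z
  have h1 : (0 : ℂ) ≤ ((m : ℕ) : ℂ)⁻¹ := by
    rw [inv_nonneg]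
    exact Nat.cast_nonneg _
  exact mul_nonneg h1 (Finset.sum_nonneg fun w _ => star_mul_self_nonneg _)

theorem norm_transfer_le (m : ℕ+) (f : A) : ‖transfer m f‖ ≤ ‖f‖ := by
  rw [ContinuousMap.norm_le _ (norm_nonneg _)]
  intro z
  have hm : (0 : ℝ) < (m : ℕ) := by exact_mod_cast m.pos
  rw [transfer_apply, norm_mul, norm_inv, Complex.norm_natCast, inv_mul_le_iff₀ hm]
  calc ‖∑ w ∈ roots m z, f w‖ ≤ ∑ w ∈ roots m z, ‖f‖ :=
        norm_sum_le_of_le _ fun w _ => f.norm_coe_le_norm w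
    _ = (roots m z).card * ‖f‖ := by simp
    _ ≤ (m : ℕ) * ‖f‖ := by
        gcongr
        exact card_roots_le m z

theorem norm_sq_le_transfer (m : ℕ+) (f : A) (z : Circle) :
    ‖f z‖ ^ 2 ≤ (m : ℕ) * ‖transfer m (star f * f)‖ := by
  have hm : (0 : ℝ) < (m : ℕ) := by exact_mod_cast m.pos
  have h := (transfer m (star f * f)).norm_coe_le_norm (z ^ (m : ℕ))
  rw [transfer_apply, norm_mul, norm_inv, Complex.norm_natCast, inv_mul_le_iff₀ hm] at h
  refine le_trans ?_ h
  have h2 : ∀ w : Circle, (star f * f) w = ((‖f w‖ ^ 2 : ℝ) : ℂ) := fun w => by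
    simp [ContinuousMap.mul_apply, ContinuousMap.star_apply, Complex.conj_mul']
  simp only [h2]
  rw [← Complex.ofReal_sum, Complex.norm_real]
  refine le_trans ?_ (le_abs_self _)
  exact Finset.single_le_sum (f := fun w : Circle => ‖f w‖ ^ 2)
    (fun w _ => by positivity) (mem_roots.2 rfl)

/-- The fibre `X_m`: a copy of the vector space `C(𝕋)`, whose element `⟨ξ⟩` is written `ξ 𝟙_m`. -/
@[ext] structure Fib (m : ℕ+) : Type where
  /-- the function `ξ` underlying `ξ 𝟙_m` -/
  fn : A

/-- The identification of `X_m` with `C(𝕋)` as sets. -/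
def fibEquiv (m : ℕ+) : Fib m ≃ A := ⟨Fib.fn, Fib.mk, fun _ => rfl, fun _ => rfl⟩

instance (m : ℕ+) : AddCommGroup (Fib m) := (fibEquiv m).addCommGroup

instance (m : ℕ+) : Module ℂ (Fib m) := (fibEquiv m).module ℂ

@[simp] theorem fn_add {m : ℕ+} (ξ η : Fib m) : (ξ + η).fn = ξ.fn + η.fn := rfl
@[simp] theorem fn_zero {m : ℕ+} : (0 : Fib m).fn = 0 := rfl
@[simp] theorem fn_smul {m : ℕ+} (c : ℂ) (ξ : Fib m) : (c • ξ).fn = c • ξ.fn := rfl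

/-- The right action `(ξ 𝟙_m) · a = (ξ α_m(a)) 𝟙_m`. As `A` is commutative it is harmless
to write it on the left, as Mathlib's `CStarModule` wants it. -/
instance (m : ℕ+) : SMul A (Fib m) := ⟨fun a ξ => ⟨ξ.fn * alpha m a⟩⟩

@[simp] theorem fn_act {m : ℕ+} (a : A) (ξ : Fib m) : (a • ξ).fn = ξ.fn * alpha m a := rfl

/-- The left action `φ_m(a) (ξ 𝟙_m) = (a ξ) 𝟙_m`. -/
def leftAct {m : ℕ+} (a : A) (ξ : Fib m) : Fib m := ⟨a * ξ.fn⟩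

/-- The inner product `⟨ξ 𝟙_m, η 𝟙_m⟩_m = L_m(ξ^* η)`. -/
instance (m : ℕ+) : Inner A (Fib m) := ⟨fun ξ η => transfer m (star ξ.fn * η.fn)⟩

theorem inner_def {m : ℕ+} (ξ η : Fib m) : inner A ξ η = transfer m (star ξ.fn * η.fn) := rfl

/-- The norm `‖ξ‖ = ‖⟨ξ, ξ⟩_m‖ ^ (1/2)`. -/
instance (m : ℕ+) : Norm (Fib m) := ⟨fun ξ => √‖inner A ξ ξ‖⟩

theorem norm_def {m : ℕ+} (ξ : Fib m) : ‖ξ‖ = √‖inner A ξ ξ‖ := rfl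

theorem norm_fn_le {m : ℕ+} (ξ : Fib m) : ‖ξ.fn‖ ≤ √(m : ℕ) * ‖ξ‖ := by
  rw [norm_def, ← Real.sqrt_mul (Nat.cast_nonneg _), ContinuousMap.norm_le _ (Real.sqrt_nonneg _)]
  intro z
  exact Real.le_sqrt_of_sq_le (norm_sq_le_transfer m ξ.fn z)

theorem norm_le_fn {m : ℕ+} (ξ : Fib m) : ‖ξ‖ ≤ ‖ξ.fn‖ := by
  rw [norm_def, Real.sqrt_le_left (norm_nonneg _), inner_def]
  refine (norm_transfer_le m _).trans ?_
  rw [CStarRing.norm_star_mul_self, sq]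

instance (m : ℕ+) : CStarModule A (Fib m) where
  inner_add_right {x y z} := by simp [inner_def, mul_add]
  inner_self_nonneg {x} := transfer_nonneg m x.fn
  inner_self {x} := by
    constructor
    · intro h
      have h1 := norm_fn_le x
      rw [norm_def, h] at h1
      have h2 : x.fn = 0 := by simpa using h1
      exact Fib.ext h2
    · rintro rfl
      simp [inner_def]
  inner_op_smul_right {a x y} := by
    rw [inner_def, inner_def, fn_act, ← mul_assoc, transfer_mul_alpha, mul_comm]
  inner_smul_right_complex {c x y} := by simp [inner_def]
  star_inner x y := by rw [inner_def, inner_def, star_transfer]; simp [mul_comm]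
  norm_eq_sqrt_norm_inner_self _ := rfl

theorem inner_add {m : ℕ+} (ξ η ζ : Fib m) :
    (inner A ξ (η + ζ) : A) = inner A ξ η + inner A ξ ζ := by
  simp [inner_def, mul_add]

theorem inner_smul {m : ℕ+} (c : ℂ) (ξ η : Fib m) :
    (inner A ξ (c • η) : A) = c • inner A ξ η := by
  simp [inner_def]

theorem inner_act {m : ℕ+} (a : A) (ξ η : Fib m) :
    (inner A ξ (a • η) : A) = inner A ξ η * a := by
  rw [inner_def, inner_def, fn_act, ← mul_assoc, transfer_mul_alpha]

instance (m : ℕ+) : NormedAddCommGroup (Fib m) :=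
  NormedAddCommGroup.ofCore (CStarModule.normedSpaceCore A)

instance (m : ℕ+) : NormedSpace ℂ (Fib m) := .ofCore (CStarModule.normedSpaceCore A)

/-- The multiplication `(ξ 𝟙_m)(η 𝟙_r) = (ξ α_m(η)) 𝟙_{mr}` of the product system. -/
instance (m r : ℕ+) : HMul (Fib m) (Fib r) (Fib (m * r)) := ⟨fun ξ η => ⟨ξ.fn * alpha m η.fn⟩⟩

theorem fn_mul {m r : ℕ+} (ξ : Fib m) (η : Fib r) : (ξ * η).fn = ξ.fn * alpha m η.fn := rfl


open Classical in
theorem transfer_transfer (m r : ℕ+) (f : A) :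
    transfer r (transfer m f) = transfer (m * r) f := by
  ext z
  simp only [transfer_apply]
  have hmap : ∀ w ∈ roots (m * r) z, w ^ (m : ℕ) ∈ roots r z := by
    intro w hw
    rw [mem_roots] at hw ⊢
    rw [← pow_mul, ← hw, PNat.mul_coe]
  rw [← Finset.mul_sum, ← mul_assoc, ← Finset.sum_fiberwise_of_maps_to hmap]
  congr 1
  · rw [PNat.mul_coe]
    push_cast
    rw [mul_inv, mul_comm]
  · refine Finset.sum_congr rfl fun v hv => Finset.sum_congr ?_ fun _ _ => rfl
    ext w
    rw [Finset.mem_filter, mem_roots, mem_roots]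
    constructor
    · intro h
      refine ⟨?_, h⟩
      rw [PNat.mul_coe, pow_mul, h, mem_roots.1 hv]
    · exact fun h => h.2

/-- The multiplication `X_m × X_r → X_{mr}` induces an isometric map on `X_m ⊗_A X_r`; this map is
onto since `(ξ 𝟙_m) 𝟙_r = ξ 𝟙_{mr}`. -/
theorem inner_mul_mul {m r : ℕ+} (ξ₁ ξ₂ : Fib m) (η₁ η₂ : Fib r) :
    (inner A (ξ₁ * η₁) (ξ₂ * η₂) : A) = inner A η₁ (leftAct (inner A ξ₁ ξ₂ : A) η₂) := by
  simp only [inner_def, fn_mul, leftAct]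
  rw [← transfer_transfer]
  congr 1
  have h := transfer_mul_alpha m (star ξ₁.fn * ξ₂.fn) (star η₁.fn * η₂.fn)
  rw [mul_left_comm (star η₁.fn), ← h]
  congr 1
  rw [star_mul, _root_.map_mul, map_star]
  ring

/-- `X_m` and `C(𝕋)` are isomorphic as topological vector spaces. -/
def fibCLE (m : ℕ+) : Fib m ≃L[ℂ] A :=
  LinearEquiv.toContinuousLinearEquivOfBounds
    { fibEquiv m with
      map_add' := fun _ _ => rfl
      map_smul' := fun _ _ => rfl } (√(m : ℕ)) 1
    (fun ξ => norm_fn_le ξ) (fun f => by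
      rw [one_mul]
      exact norm_le_fn (⟨f⟩ : Fib m))

@[simp] theorem fibCLE_apply {m : ℕ+} (ξ : Fib m) : fibCLE m ξ = ξ.fn := rfl

@[simp] theorem fibCLE_symm_apply {m : ℕ+} (f : A) : (fibCLE m).symm f = ⟨f⟩ := rfl

instance (m : ℕ+) : CompleteSpace (Fib m) :=
  (fibCLE m).symm.isUniformEmbedding.isUniformInducing.completeSpace_congr
    (fibCLE m).symm.surjective |>.1 inferInstance

/-- The right action of a fixed `a ∈ A`, as a bounded operator. -/
def actL {m : ℕ+} (a : A) : Fib m →L[ℂ] Fib m :=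
  (fibCLE m).symm.toContinuousLinearMap ∘L
    (ContinuousLinearMap.mul ℂ A (alpha m a)) ∘L (fibCLE m).toContinuousLinearMap

theorem actL_apply {m : ℕ+} (a : A) (ξ : Fib m) : actL a ξ = a • ξ := by
  ext1
  simp [actL, mul_comm]

/-- The rank-one operator `θ_{ξ,η}(ζ) = ξ · ⟨η, ζ⟩_m`. -/
def theta {m : ℕ+} (ξ η : Fib m) : Fib m →L[ℂ] Fib m where
  toFun ζ := (inner A η ζ : A) • ξ
  map_add' x y := by ext1; simp [inner_add, mul_add]
  map_smul' c x := by ext1; simp [inner_smul]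
  cont := by
    have h : (fun ζ : Fib m => (inner A η ζ : A) • ξ) = fun ζ => (fibCLE m).symm
        (ξ.fn * alpha m (inner A η ζ : A)) := rfl
    have h2 : Continuous fun f : A => alpha m f :=
      ContinuousMap.continuous_precomp _
    have h3 : Continuous fun ζ : Fib m => (inner A η ζ : A) :=
      (CStarModule.innerSL (A := A) η).continuous
    change Continuous (fun ζ : Fib m => (inner A η ζ : A) • ξ)
    rw [h]
    fun_prop

theorem theta_apply {m : ℕ+} (ξ η ζ : Fib m) : theta ξ η ζ = (inner A η ζ : A) • ξ := rfl

/-- The compact operators `𝒦(X_m)`: the closed linear span, in the operator norm, of the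
rank-one operators. -/
def Compact (m : ℕ+) : Submodule ℂ (Fib m →L[ℂ] Fib m) :=
  (Submodule.span ℂ {T | ∃ ξ η : Fib m, T = theta ξ η}).topologicalClosure

theorem theta_mem {m : ℕ+} (ξ η : Fib m) : theta ξ η ∈ Compact m :=
  Submodule.le_topologicalClosure _ (Submodule.subset_span ⟨ξ, η, rfl⟩)

/-- `θ_{ξ,η}` as an element of `𝒦(X_m)`. -/
def thetaK {m : ℕ+} (ξ η : Fib m) : Compact m := ⟨theta ξ η, theta_mem ξ η⟩

open Classical in
/-- The standard generators `Z^k 𝟙_m` reconstruct every element of `X_m`. -/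
theorem reconstruction {m : ℕ+} (ξ : Fib m) :
    ∑ k ∈ Finset.range m, theta ⟨Z ^ k⟩ ⟨Z ^ k⟩ ξ = ξ := by
  apply (fibCLE m).injective
  rw [map_sum]
  ext z
  have hm : ((m : ℕ) : ℂ) ≠ 0 := by exact_mod_cast m.ne_zero
  have hZ : ∀ (k : ℕ) (w : Circle), (Z ^ k : A) w = (w : ℂ) ^ k := fun k w => by
    rw [ContinuousMap.pow_apply]; rfl
  simp only [fibCLE_apply, theta_apply, fn_act, inner_def, ContinuousMap.sum_apply,
    ContinuousMap.mul_apply, alpha_apply, transfer_apply, ContinuousMap.star_apply, hZ]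
  have key : ∀ w ∈ roots m (z ^ (m : ℕ)),
      ∑ k ∈ Finset.range m, (z : ℂ) ^ k * star ((w : ℂ) ^ k) = if w = z then ((m : ℕ) : ℂ) else 0 := by
    intro w hw
    have hw' := mem_roots.1 hw
    have e : ∀ k : ℕ, (z : ℂ) ^ k * star ((w : ℂ) ^ k) = ((z * w⁻¹ : Circle) : ℂ) ^ k := by
      intro k
      rw [Circle.coe_mul, Circle.coe_inv_eq_conj, mul_pow, star_pow]
      rfl
    simp only [e]
    split_ifs with h
    · subst h
      simp
    · have hne : ((z * w⁻¹ : Circle) : ℂ) ≠ 1 := by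
        intro h1
        apply h
        have : z * w⁻¹ = 1 := Circle.coe_injective (by simpa using h1)
        exact (mul_inv_eq_one.1 this).symm
      rw [geom_sum_eq hne]
      have : ((z * w⁻¹ : Circle) : ℂ) ^ (m : ℕ) = 1 := by
        rw [← Circle.coe_pow, mul_pow, inv_pow, hw']
        simp
      rw [this]
      simp
  calc ∑ k ∈ Finset.range m, (z : ℂ) ^ k * (((m : ℕ) : ℂ)⁻¹ *
        ∑ w ∈ roots m (z ^ (m : ℕ)), star ((w : ℂ) ^ k) * ξ.fn w)
      = ((m : ℕ) : ℂ)⁻¹ * ∑ w ∈ roots m (z ^ (m : ℕ)),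
          (∑ k ∈ Finset.range m, (z : ℂ) ^ k * star ((w : ℂ) ^ k)) * ξ.fn w := by
        simp only [Finset.mul_sum, Finset.sum_mul]
        rw [Finset.sum_comm]
        refine Finset.sum_congr rfl fun w _ => Finset.sum_congr rfl fun k _ => ?_
        ring
    _ = ((m : ℕ) : ℂ)⁻¹ * ∑ w ∈ roots m (z ^ (m : ℕ)),
          (if w = z then ((m : ℕ) : ℂ) else 0) * ξ.fn w := by
        congr 1
        exact Finset.sum_congr rfl fun w hw => by rw [key w hw]
    _ = ξ.fn z := by
        rw [Finset.sum_eq_single z]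
        · simp [hm]
        · intro w _ hw
          simp [hw]
        · intro h
          exact absurd (mem_roots.2 rfl) h

/-- A bounded operator on `X_m` is compact exactly when it is a right `A`-module map
(in particular the identity is compact, and every adjointable operator is). -/
theorem mem_compact_iff {m : ℕ+} (T : Fib m →L[ℂ] Fib m) :
    T ∈ Compact m ↔ ∀ (a : A) (ξ : Fib m), T (a • ξ) = a • T ξ := by
  constructor
  · intro hT a ξ
    have hcl : IsClosed {S : Fib m →L[ℂ] Fib m | S (a • ξ) = a • S ξ} := by
      simp only [← actL_apply]
      exact isClosed_eq (by fun_prop) (by fun_prop)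
    refine closure_minimal ?_ hcl hT
    intro S hS
    induction hS using Submodule.span_induction with
    | mem x hx =>
      obtain ⟨ζ, η, rfl⟩ := hx
      change theta ζ η (a • ξ) = a • theta ζ η ξ
      rw [theta_apply, theta_apply, inner_act]
      ext1
      simp only [fn_act, _root_.map_mul]
      ring
    | zero => ext1; simp
    | add x y _ _ hx hy =>
      have hx' : x (a • ξ) = a • x ξ := hx
      have hy' : y (a • ξ) = a • y ξ := hy
      ext1
      simp [hx', hy', add_mul]
    | smul c x _ hx =>
      have hx' : x (a • ξ) = a • x ξ := hx
      ext1
      simp [hx']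
  · intro h
    have : T = ∑ k ∈ Finset.range m, theta (T ⟨Z ^ k⟩) ⟨Z ^ k⟩ := by
      ext1 ξ
      conv_lhs => rw [← reconstruction ξ]
      rw [map_sum, _root_.sum_apply]
      refine Finset.sum_congr rfl fun k _ => ?_
      rw [theta_apply, theta_apply, h]
    rw [this]
    exact Submodule.sum_mem _ fun k _ => theta_mem _ _

theorem eq_sum_theta {m : ℕ+} (T : Compact m) :
    T = ∑ k ∈ Finset.range m, thetaK (T.1 ⟨Z ^ k⟩) ⟨Z ^ k⟩ := by
  apply Subtype.ext
  ext1 ξ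
  conv_lhs => rw [← reconstruction ξ]
  rw [map_sum, Submodule.coe_sum, _root_.sum_apply]
  refine Finset.sum_congr rfl fun k _ => ?_
  change T.1 _ = theta _ _ _
  rw [theta_apply, theta_apply, (mem_compact_iff _).1 T.2]

/-- The embedding `i_m^r`, for `m ∣ r`. When `r = m k`, the isomorphism `F : X_m ⊗_A X_k → X_r`
given by multiplication has inverse `ζ 𝟙_r ↦ ζ 𝟙_m ⊗ 𝟙_k`, so that `F (S ⊗ I) F^*` sends `ζ 𝟙_r`
to `(S (ζ 𝟙_m)) 𝟙_k`, which has the same underlying function as `S (ζ 𝟙_m)`. -/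
def amp (m r : ℕ+) (S : Fib m →L[ℂ] Fib m) : Fib r →L[ℂ] Fib r :=
  ((fibCLE r).symm.toContinuousLinearMap ∘L (fibCLE m).toContinuousLinearMap) ∘L S ∘L
    ((fibCLE m).symm.toContinuousLinearMap ∘L (fibCLE r).toContinuousLinearMap)

theorem amp_apply (m r : ℕ+) (S : Fib m →L[ℂ] Fib m) (ζ : Fib r) :
    amp m r S ζ = ⟨(S ⟨ζ.fn⟩).fn⟩ := rfl

/-- For a module map `S`, `i_m^{mk}(S)` is the operator `R` on `X_{mk}` determined by
`R (ξ η) = (S ξ) η` for `ξ ∈ X_m`, `η ∈ X_k`; that is, `R = F (S ⊗ I) F^*`. -/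
theorem eq_amp_iff {m k : ℕ+} {S : Fib m →L[ℂ] Fib m}
    (hS : ∀ (a : A) (ξ : Fib m), S (a • ξ) = a • S ξ) (R : Fib (m * k) →L[ℂ] Fib (m * k)) :
    R = amp m (m * k) S ↔ ∀ (ξ : Fib m) (η : Fib k), R (ξ * η) = S ξ * η := by
  constructor
  · rintro rfl ξ η
    ext1
    rw [fn_mul, ← fn_act, ← hS]
    rfl
  · intro h
    ext1 ζ
    have h1 := h ⟨ζ.fn⟩ (⟨1⟩ : Fib k)
    have h2 : (⟨ζ.fn⟩ : Fib m) * (⟨1⟩ : Fib k) = ζ := by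
      ext1
      simp [fn_mul]
    rw [h2] at h1
    rw [h1]
    ext1
    simp [fn_mul, amp_apply]

theorem amp_mem {m r : ℕ+} (h : m ∣ r) {S : Fib m →L[ℂ] Fib m} (hS : S ∈ Compact m) :
    amp m r S ∈ Compact r := by
  rw [mem_compact_iff] at hS ⊢
  intro a ξ
  obtain ⟨k, rfl⟩ := h
  ext1
  have e : alpha (m * k) a = alpha m (alpha k a) := by
    ext z
    simp [alpha_apply, pow_mul]
  rw [fn_act, e]
  change _ = (alpha k a • S ⟨ξ.fn⟩).fn
  rw [← hS, amp_apply, fn_act, e]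
  rfl

theorem comp_mem {m : ℕ+} {S T : Fib m →L[ℂ] Fib m} (hS : S ∈ Compact m) (hT : T ∈ Compact m) :
    S ∘L T ∈ Compact m := by
  rw [mem_compact_iff] at hS hT ⊢
  intro a ξ
  simp [hS, hT]

/-- `X` is compactly aligned: `i_m^{m ∨ n}(S) i_n^{m ∨ n}(T) ∈ 𝒦(X_{m ∨ n})` for
`S ∈ 𝒦(X_m)` and `T ∈ 𝒦(X_n)`, where `m ∨ n = lcm(m, n)`. Here is this product. -/
def alignedProd {m n : ℕ+} (S : Compact m) (T : Compact n) : Compact (m.lcm n) :=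
  ⟨amp m (m.lcm n) S.1 ∘L amp n (m.lcm n) T.1,
    comp_mem (amp_mem (PNat.dvd_lcm_left m n) S.2) (amp_mem (PNat.dvd_lcm_right m n) T.2)⟩

/-- A Toeplitz representation of the product system `X` in a C⋆-algebra `C`. -/
structure ToeplitzRep (C : Type*) [NonUnitalCStarAlgebra C] where
  /-- the component `ψ_m`, a linear map -/
  toFun (m : ℕ+) : Fib m →ₗ[ℂ] C
  /-- `ψ_1` is a homomorphism on `X_1 = A` -/
  base_mul (f g : A) : toFun 1 ⟨f * g⟩ = toFun 1 ⟨f⟩ * toFun 1 ⟨g⟩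
  /-- `ψ_1` preserves adjoints -/
  base_star (f : A) : toFun 1 ⟨star f⟩ = star (toFun 1 ⟨f⟩)
  toFun_mul (m n : ℕ+) (ξ : Fib m) (η : Fib n) : toFun m ξ * toFun n η = toFun (m * n) (ξ * η)
  star_mul_toFun (m : ℕ+) (ξ η : Fib m) : star (toFun m ξ) * toFun m η = toFun 1 ⟨inner A ξ η⟩

/-- Nica covariance of a Toeplitz representation `ψ`. The map `ψ^{(m)} : 𝒦(X_m) → C` with
`ψ^{(m)}(θ_{ξ,η}) = ψ_m(ξ) ψ_m(η)^*`, here `κ m`, is determined by this formula, linearity and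
continuity. -/
def ToeplitzRep.IsNicaCovariant {C : Type*} [NonUnitalCStarAlgebra C] (ψ : ToeplitzRep C) : Prop :=
  ∃ κ : (m : ℕ+) → Compact m →L[ℂ] C,
    (∀ (m : ℕ+) (ξ η : Fib m), κ m (thetaK ξ η) = ψ.toFun m ξ * star (ψ.toFun m η)) ∧
    ∀ (m n : ℕ+) (S : Compact m) (T : Compact n), κ m S * κ n T = κ (m.lcm n) (alignedProd S T)

namespace ToeplitzRep

variable {C : Type*} [NonUnitalCStarAlgebra C]

/-- `ψ_1` as a `*`-homomorphism on `A`. -/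
def base (ψ : ToeplitzRep C) : A →⋆ₙₐ[ℂ] C where
  toFun f := ψ.toFun 1 ⟨f⟩
  map_smul' c f := (ψ.toFun 1).map_smul c ⟨f⟩
  map_zero' := (ψ.toFun 1).map_zero
  map_add' f g := (ψ.toFun 1).map_add ⟨f⟩ ⟨g⟩
  map_mul' := ψ.base_mul
  map_star' := ψ.base_star

theorem base_apply (ψ : ToeplitzRep C) (f : A) : ψ.base f = ψ.toFun 1 ⟨f⟩ := rfl

theorem norm_le (ψ : ToeplitzRep C) {m : ℕ+} (ξ : Fib m) : ‖ψ.toFun m ξ‖ ≤ ‖ξ‖ := by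
  rw [norm_def]
  apply Real.le_sqrt_of_sq_le
  rw [sq, ← CStarRing.norm_star_mul_self, ψ.star_mul_toFun, ← base_apply]
  exact NonUnitalStarAlgHom.norm_apply_le ψ.base _

theorem continuous (ψ : ToeplitzRep C) (m : ℕ+) : Continuous (ψ.toFun m) :=
  AddMonoidHomClass.continuous_of_bound (ψ.toFun m) 1 fun ξ => by
    rw [one_mul]
    exact ψ.norm_le ξ

/-- `ψ_m(ξ · a) = ψ_m(ξ) ψ_1(a)`. -/
theorem map_act (ψ : ToeplitzRep C) {m : ℕ+} (a : A) (ξ : Fib m) :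
    ψ.toFun m (a • ξ) = ψ.toFun m ξ * ψ.base a := by
  have key : ∀ (r : ℕ+) (h : r = m) (ζ : Fib r) (ξ' : Fib m), ζ.fn = ξ'.fn →
      ψ.toFun r ζ = ψ.toFun m ξ' := by
    rintro r rfl ζ ξ' h'
    rw [Fib.ext h']
  rw [base_apply, ψ.toFun_mul]
  exact (key (m * 1) (mul_one m) _ _ rfl).symm

/-- `ψ_1(a) ψ_m(ξ) = ψ_m(a · ξ)`. -/
theorem map_leftAct (ψ : ToeplitzRep C) {m : ℕ+} (a : A) (ξ : Fib m) :
    ψ.base a * ψ.toFun m ξ = ψ.toFun m (leftAct a ξ) := by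
  have key : ∀ (r : ℕ+) (h : r = m) (ζ : Fib r) (ξ' : Fib m), ζ.fn = ξ'.fn →
      ψ.toFun r ζ = ψ.toFun m ξ' := by
    rintro r rfl ζ ξ' h'
    rw [Fib.ext h']
  rw [base_apply, ψ.toFun_mul]
  refine key (1 * m) (one_mul m) _ _ ?_
  rw [fn_mul]
  ext z
  simp [leftAct, alpha_apply]

/-- The homomorphism `ψ^{(m)} : 𝒦(X_m) → C`. -/
def pimsner (ψ : ToeplitzRep C) (m : ℕ+) : Compact m →L[ℂ] C where
  toFun T := ∑ k ∈ Finset.range m, ψ.toFun m (T.1 ⟨Z ^ k⟩) * star (ψ.toFun m ⟨Z ^ k⟩)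
  map_add' S T := by simp [add_mul, Finset.sum_add_distrib]
  map_smul' c T := by simp [Finset.smul_sum, smul_mul_assoc]
  cont := by
    have := ψ.continuous m
    change Continuous fun T : Compact m =>
      ∑ k ∈ Finset.range m, ψ.toFun m (T.1 ⟨Z ^ k⟩) * star (ψ.toFun m ⟨Z ^ k⟩)
    fun_prop

theorem pimsner_apply (ψ : ToeplitzRep C) {m : ℕ+} (T : Compact m) : ψ.pimsner m T =
    ∑ k ∈ Finset.range m, ψ.toFun m (T.1 ⟨Z ^ k⟩) * star (ψ.toFun m ⟨Z ^ k⟩) := rfl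

theorem pimsner_theta (ψ : ToeplitzRep C) {m : ℕ+} (ξ η : Fib m) :
    ψ.pimsner m (thetaK ξ η) = ψ.toFun m ξ * star (ψ.toFun m η) := by
  conv_rhs => rw [← reconstruction η, map_sum, star_sum, Finset.mul_sum]
  rw [pimsner_apply]
  refine Finset.sum_congr rfl fun k _ => ?_
  change ψ.toFun m (theta ξ η ⟨Z ^ k⟩) * _ = _
  rw [theta_apply, theta_apply, map_act, map_act, star_mul, ← map_star ψ.base, mul_assoc]
  congr 4
  exact (CStarModule.star_inner (A := A) (⟨Z ^ k⟩ : Fib m) η).symm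

theorem isNicaCovariant_iff (ψ : ToeplitzRep C) : ψ.IsNicaCovariant ↔
    ∀ (m n : ℕ+) (S : Compact m) (T : Compact n),
      ψ.pimsner m S * ψ.pimsner n T = ψ.pimsner (m.lcm n) (alignedProd S T) := by
  constructor
  · rintro ⟨κ, h1, h2⟩
    have h3 : κ = ψ.pimsner := by
      funext m
      ext1 T
      rw [eq_sum_theta T, map_sum, map_sum]
      exact Finset.sum_congr rfl fun k _ => by rw [h1, pimsner_theta]
    rwa [h3] at h2
  · exact fun h => ⟨ψ.pimsner, fun m ξ η => ψ.pimsner_theta ξ η, h⟩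

/-- Composition of a Toeplitz representation with a `*`-homomorphism. -/
def comp {D : Type*} [NonUnitalCStarAlgebra D] (ψ : ToeplitzRep C) (π : C →⋆ₙₐ[ℂ] D) :
    ToeplitzRep D where
  toFun m :=
    { toFun := fun ξ => π (ψ.toFun m ξ)
      map_add' := fun ξ η => by simp
      map_smul' := fun c ξ => by simp }
  base_mul f g := by simp [ψ.base_mul]
  base_star f := by simp [ψ.base_star, map_star]
  toFun_mul m n ξ η := by simp [← ψ.toFun_mul]
  star_mul_toFun m ξ η := by simp [← ψ.star_mul_toFun, map_star]

theorem pimsner_comp {D : Type*} [NonUnitalCStarAlgebra D] (ψ : ToeplitzRep C)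
    (π : C →⋆ₙₐ[ℂ] D) {m : ℕ+} (T : Compact m) :
    (ψ.comp π).pimsner m T = π (ψ.pimsner m T) := by
  simp [pimsner_apply, comp, map_star]

theorem IsNicaCovariant.comp {D : Type*} [NonUnitalCStarAlgebra D] {ψ : ToeplitzRep C}
    (h : ψ.IsNicaCovariant) (π : C →⋆ₙₐ[ℂ] D) : (ψ.comp π).IsNicaCovariant := by
  rw [isNicaCovariant_iff] at h ⊢
  intro m n S T
  rw [pimsner_comp, pimsner_comp, pimsner_comp, ← _root_.map_mul, h]

theorem IsNicaCovariant.of_comp {D : Type*} [NonUnitalCStarAlgebra D] {ψ : ToeplitzRep C}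
    {π : C →⋆ₙₐ[ℂ] D} (hπ : Function.Injective π) (h : (ψ.comp π).IsNicaCovariant) :
    ψ.IsNicaCovariant := by
  rw [isNicaCovariant_iff] at h ⊢
  intro m n S T
  apply hπ
  rw [_root_.map_mul, ← pimsner_comp, ← pimsner_comp, ← pimsner_comp, h]

/-- The closed `*`-subalgebra generated by the image of a Toeplitz representation. -/
def range (ψ : ToeplitzRep C) : NonUnitalStarSubalgebra ℂ C :=
  (NonUnitalStarAlgebra.adjoin ℂ {x | ∃ (m : ℕ+) (ξ : Fib m), x = ψ.toFun m ξ}).topologicalClosure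

theorem isClosed_range (ψ : ToeplitzRep C) : IsClosed (ψ.range : Set C) :=
  NonUnitalStarSubalgebra.isClosed_topologicalClosure _

theorem mem_range (ψ : ToeplitzRep C) {m : ℕ+} (ξ : Fib m) : ψ.toFun m ξ ∈ ψ.range :=
  NonUnitalStarSubalgebra.le_topologicalClosure _
    (NonUnitalStarAlgebra.subset_adjoin ℂ _ ⟨m, ξ, rfl⟩)

instance (ψ : ToeplitzRep C) : NonUnitalCStarAlgebra ψ.range :=
  NonUnitalStarSubalgebra.nonUnitalCStarAlgebra ψ.range (h_closed := ψ.isClosed_range)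

/-- A Toeplitz representation as a representation in the C⋆-algebra generated by its image. -/
def corestrict (ψ : ToeplitzRep C) : ToeplitzRep ψ.range where
  toFun m :=
    { toFun := fun ξ => ⟨ψ.toFun m ξ, ψ.mem_range ξ⟩
      map_add' := fun _ _ => Subtype.ext (map_add _ _ _)
      map_smul' := fun _ _ => Subtype.ext (map_smul _ _ _) }
  base_mul f g := Subtype.ext (ψ.base_mul f g)
  base_star f := Subtype.ext (ψ.base_star f)
  toFun_mul m n ξ η := Subtype.ext (ψ.toFun_mul m n ξ η)
  star_mul_toFun m ξ η := Subtype.ext (ψ.star_mul_toFun m ξ η)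

theorem IsNicaCovariant.corestrict {ψ : ToeplitzRep C} (h : ψ.IsNicaCovariant) :
    ψ.corestrict.IsNicaCovariant :=
  IsNicaCovariant.of_comp (π := NonUnitalStarSubalgebraClass.subtype ψ.range)
    Subtype.val_injective h

/-- Induction principle for the C⋆-algebra generated by the image of `ψ`. -/
theorem induction_range (ψ : ToeplitzRep C) {p : C → Prop} (hcl : IsClosed {x | p x})
    (h0 : ∀ (m : ℕ+) (ξ : Fib m), p (ψ.toFun m ξ)) (hz : p 0)
    (hadd : ∀ x y, p x → p y → p (x + y)) (hmul : ∀ x y, p x → p y → p (x * y))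
    (hsmul : ∀ (c : ℂ) x, p x → p (c • x)) (hstar : ∀ x, p x → p (star x))
    {x : C} (hx : x ∈ ψ.range) : p x := by
  refine closure_minimal ?_ hcl hx
  intro y hy
  induction hy using NonUnitalStarAlgebra.adjoin_induction with
  | mem x h =>
    obtain ⟨m, ξ, rfl⟩ := h
    exact h0 m ξ
  | add x y _ _ hx hy => exact hadd x y hx hy
  | zero => exact hz
  | mul x y _ _ hx hy => exact hmul x y hx hy
  | smul c x _ hx => exact hsmul c x hx
  | star x _ hx => exact hstar x hx

theorem one_mul_range (ψ : ToeplitzRep C) {x : C} (hx : x ∈ ψ.range) :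
    ψ.base 1 * x = x ∧ x * ψ.base 1 = x := by
  have hs : star (ψ.base 1) = ψ.base 1 := by rw [← map_star, star_one]
  refine ψ.induction_range (p := fun x => ψ.base 1 * x = x ∧ x * ψ.base 1 = x)
    ?_ ?_ ?_ ?_ ?_ ?_ ?_ hx
  · exact (isClosed_eq (by fun_prop) (by fun_prop)).inter (isClosed_eq (by fun_prop) (by fun_prop))
  · intro m ξ
    constructor
    · rw [map_leftAct]
      congr 1
      ext1
      simp [leftAct]
    · rw [← map_act]
      congr 1
      ext1
      simp
  · simp
  · rintro x y ⟨h1, h2⟩ ⟨h3, h4⟩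
    exact ⟨by rw [mul_add, h1, h3], by rw [add_mul, h2, h4]⟩
  · rintro x y ⟨h1, h2⟩ ⟨h3, h4⟩
    exact ⟨by rw [← mul_assoc, h1], by rw [mul_assoc, h4]⟩
  · rintro c x ⟨h1, h2⟩
    exact ⟨by rw [mul_smul_comm, h1], by rw [smul_mul_assoc, h2]⟩
  · rintro x ⟨h1, h2⟩
    constructor
    · rw [← hs, ← star_mul, h2]
    · rw [← hs, ← star_mul, h1]

end ToeplitzRep

/-- A C⋆-algebra with a two-sided identity element is a unital C⋆-algebra. -/
def cstarAlgebraOfUnit {D : Type*} [NonUnitalCStarAlgebra D] (e : D)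
    (h1 : ∀ x, e * x = x) (h2 : ∀ x, x * e = x) : CStarAlgebra D :=
  letI : Ring D := { (inferInstance : NonUnitalRing D) with
    one := e
    one_mul := h1
    mul_one := h2 }
  { (inferInstance : NonUnitalNormedRing D), (inferInstance : Ring D),
    (inferInstance : StarRing D), (inferInstance : CompleteSpace D),
    (inferInstance : CStarRing D), (inferInstance : StarModule ℂ D),
    Algebra.ofModule (R := ℂ) (A := D) smul_mul_assoc mul_smul_comm with
    norm_smul_le := norm_smul_le }

/-- A Nica covariant Toeplitz representation of `X` in some C⋆-algebra with carrier in `Type`.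
The image of any representation generates a separable C⋆-algebra, so this loses nothing: see
`exists_unique_lift` for the universal property in all universes. -/
structure NicaRep : Type 1 where
  /-- the C⋆-algebra -/
  C : Type
  [inst : NonUnitalCStarAlgebra C]
  /-- the representation -/
  ψ : ToeplitzRep C
  cov : ψ.IsNicaCovariant

instance (i : NicaRep) : NonUnitalCStarAlgebra i.C := i.inst

open scoped ENNReal

/-- The direct sum of all Nica covariant Toeplitz representations, in the `ℓ^∞`-product. -/
def sumRep : ToeplitzRep (lp (fun i : NicaRep => i.C) ∞) where
  toFun m :=
    { toFun := fun ξ => ⟨fun i => i.ψ.toFun m ξ, memℓp_infty ⟨‖ξ‖, by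
        rintro _ ⟨i, rfl⟩
        exact i.ψ.norm_le ξ⟩⟩
      map_add' := fun ξ η => by
        ext i
        exact map_add (i.ψ.toFun m) ξ η
      map_smul' := fun c ξ => by
        ext i
        exact map_smul (i.ψ.toFun m) c ξ }
  base_mul f g := by
    ext i
    exact i.ψ.base_mul f g
  base_star f := by
    ext i
    exact i.ψ.base_star f
  toFun_mul m n ξ η := by
    ext i
    exact i.ψ.toFun_mul m n ξ η
  star_mul_toFun m ξ η := by
    ext i
    exact i.ψ.star_mul_toFun m ξ η

/-- The Nica–Toeplitz algebra `𝒯_cov(X)`: the C⋆-algebra generated by the direct sum of all Nica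
covariant Toeplitz representations of `X`. -/
def TCov : Type 1 := sumRep.range

/-- `𝒯_cov(X)` is a C⋆-algebra with unit `i_1(1)`. -/
instance : CStarAlgebra TCov :=
  cstarAlgebraOfUnit (D := sumRep.range) ⟨sumRep.base 1, sumRep.mem_range _⟩
    (fun x => Subtype.ext (sumRep.one_mul_range x.2).1)
    (fun x => Subtype.ext (sumRep.one_mul_range x.2).2)

/-- The universal Nica covariant Toeplitz representation of `X` in `𝒯_cov(X)`. -/
def univRep : ToeplitzRep TCov := sumRep.corestrict

/-- The coordinate projections of the `ℓ^∞`-product. -/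
def proj (i : NicaRep) : lp (fun i : NicaRep => i.C) ∞ →⋆ₙₐ[ℂ] i.C where
  toFun x := x i
  map_smul' _ _ := rfl
  map_zero' := rfl
  map_add' _ _ := rfl
  map_mul' _ _ := rfl
  map_star' _ := rfl

theorem sumRep_cov : sumRep.IsNicaCovariant := by
  rw [ToeplitzRep.isNicaCovariant_iff]
  intro m n S T
  ext i
  have h := (ToeplitzRep.isNicaCovariant_iff _).1 i.cov m n S T
  have e : sumRep.comp (proj i) = i.ψ := rfl
  rw [← e, ToeplitzRep.pimsner_comp, ToeplitzRep.pimsner_comp, ToeplitzRep.pimsner_comp] at h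
  exact h

theorem univRep_cov : univRep.IsNicaCovariant := sumRep_cov.corestrict

/-- Formal `*`-polynomials in the elements of `X`. -/
inductive Term : Type
  | var (m : ℕ+) (ξ : Fib m)
  | zero
  | add (s t : Term)
  | mul (s t : Term)
  | smul (c : ℂ) (t : Term)
  | star (t : Term)

/-- Evaluation of a formal `*`-polynomial. -/
def Term.eval {C : Type*} [NonUnitalCStarAlgebra C] (ψ : ToeplitzRep C) : Term → C
  | var m ξ => ψ.toFun m ξ
  | zero => 0
  | add s t => s.eval ψ + t.eval ψ
  | mul s t => s.eval ψ * t.eval ψ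
  | smul c t => c • t.eval ψ
  | star t => Star.star (t.eval ψ)

theorem ToeplitzRep.small_range {C : Type*} [NonUnitalCStarAlgebra C] (ψ : ToeplitzRep C) :
    Small.{0} ψ.range := by
  have h : ∀ x : ψ.range, ∃ s : ℕ → Term,
      Filter.Tendsto (fun n => (s n).eval ψ) Filter.atTop (nhds (x : C)) := by
    intro x
    obtain ⟨y, hy, hlim⟩ := mem_closure_iff_seq_limit.1 x.2
    have h2 : ∀ z ∈ NonUnitalStarAlgebra.adjoin ℂ
        {x | ∃ (m : ℕ+) (ξ : Fib m), x = ψ.toFun m ξ}, ∃ t : Term, t.eval ψ = z := by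
      intro z hz
      induction hz using NonUnitalStarAlgebra.adjoin_induction with
      | mem x h =>
        obtain ⟨m, ξ, rfl⟩ := h
        exact ⟨.var m ξ, rfl⟩
      | add x y _ _ hx hy =>
        obtain ⟨s, rfl⟩ := hx
        obtain ⟨t, rfl⟩ := hy
        exact ⟨.add s t, rfl⟩
      | zero => exact ⟨.zero, rfl⟩
      | mul x y _ _ hx hy =>
        obtain ⟨s, rfl⟩ := hx
        obtain ⟨t, rfl⟩ := hy
        exact ⟨.mul s t, rfl⟩
      | smul c x _ hx =>
        obtain ⟨s, rfl⟩ := hx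
        exact ⟨.smul c s, rfl⟩
      | star x _ hx =>
        obtain ⟨s, rfl⟩ := hx
        exact ⟨.star s, rfl⟩
    choose s hs using fun n => h2 (y n) (hy n)
    exact ⟨s, by simpa only [hs] using hlim⟩
  choose s hs using h
  refine small_of_injective (f := s) fun x y hxy => Subtype.ext ?_
  have := hs x
  rw [hxy] at this
  exact tendsto_nhds_unique this (hs y)

/-- Transport of a C⋆-algebra structure along a bijection. -/
abbrev cstarAlgebraOfEquiv {S D : Type*} [NonUnitalCStarAlgebra D] (e : S ≃ D) :
    NonUnitalCStarAlgebra S :=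
  letI : NonUnitalRing S := e.nonUnitalRing
  letI : Module ℂ S := e.module ℂ
  letI : NonUnitalNormedRing S :=
    NonUnitalNormedRing.induced S D e.ringEquiv e.injective
  { (inferInstance : NonUnitalNormedRing S), (inferInstance : Module ℂ S) with
    star := fun x => e.symm (star (e x))
    star_involutive := fun x => by simp
    star_mul := fun x y => by simp [Equiv.mul_def]
    star_add := fun x y => by simp [Equiv.add_def]
    complete := fun {f} hf => by
      have h : IsUniformInducing e := ⟨rfl⟩
      exact ((h.completeSpace_congr e.surjective).2 inferInstance).complete hf
    norm_mul_self_le := fun x => by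
      change ‖e x‖ * ‖e x‖ ≤ ‖e (e.symm (star (e x)) * x)‖
      simp [Equiv.mul_def, CStarRing.norm_star_mul_self]
    norm_smul_le := fun c x => by
      change ‖e (c • x)‖ ≤ ‖c‖ * ‖e x‖
      simp [Equiv.smul_def, norm_smul]
    smul_assoc := fun c x y => by simp [Equiv.mul_def, Equiv.smul_def, smul_mul_assoc]
    smul_comm := fun c x y => by simp [Equiv.mul_def, Equiv.smul_def, mul_smul_comm]
    star_smul := fun c x => by
      change e.symm _ = star c • e.symm _
      simp [Equiv.smul_def] }

/-- A bijection as a `*`-isomorphism for the transported structure. -/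
def homOfEquiv {S D : Type*} [NonUnitalCStarAlgebra D] (e : S ≃ D) :
    letI := cstarAlgebraOfEquiv e
    D →⋆ₙₐ[ℂ] S :=
  letI := cstarAlgebraOfEquiv e
  { toFun := e.symm
    map_smul' := fun c x => by
      apply e.injective
      change _ = e (e.symm (c • e (e.symm x)))
      simp
    map_zero' := rfl
    map_add' := fun x y => by
      change _ = e.symm (e (e.symm x) + e (e.symm y))
      simp
    map_mul' := fun x y => by
      change _ = e.symm (e (e.symm x) * e (e.symm y))
      simp
    map_star' := fun x => by
      change _ = e.symm (star (e (e.symm x)))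
      simp }

/-- The inverse of `homOfEquiv`. -/
def invOfEquiv {S D : Type*} [NonUnitalCStarAlgebra D] (e : S ≃ D) :
    letI := cstarAlgebraOfEquiv e
    S →⋆ₙₐ[ℂ] D :=
  letI := cstarAlgebraOfEquiv e
  { toFun := e
    map_smul' := fun _ _ => e.apply_symm_apply _
    map_zero' := e.apply_symm_apply _
    map_add' := fun _ _ => e.apply_symm_apply _
    map_mul' := fun _ _ => e.apply_symm_apply _
    map_star' := fun _ => e.apply_symm_apply _ }

theorem mem_univRep_range (x : TCov) : x ∈ univRep.range := by
  have key : ∀ y : lp (fun i : NicaRep => i.C) ∞, y ∈ NonUnitalStarAlgebra.adjoin ℂ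
      {x | ∃ (m : ℕ+) (ξ : Fib m), x = sumRep.toFun m ξ} →
      ∃ hy : y ∈ sumRep.range, (⟨y, hy⟩ : TCov) ∈ univRep.range := by
    intro y hy
    induction hy using NonUnitalStarAlgebra.adjoin_induction with
    | mem x h =>
      obtain ⟨m, ξ, rfl⟩ := h
      exact ⟨sumRep.mem_range ξ, univRep.mem_range ξ⟩
    | add x y _ _ hx hy => exact ⟨add_mem hx.1 hy.1, add_mem hx.2 hy.2⟩
    | zero => exact ⟨zero_mem _, zero_mem univRep.range⟩
    | mul x y _ _ hx hy => exact ⟨mul_mem hx.1 hy.1, mul_mem hx.2 hy.2⟩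
    | smul c x _ hx =>
      obtain ⟨h1, h2⟩ := hx
      exact ⟨sumRep.range.smul_mem' c h1, univRep.range.smul_mem' c h2⟩
    | star x _ hx => exact ⟨sumRep.range.star_mem' hx.1, univRep.range.star_mem' hx.2⟩
  obtain ⟨x, hx⟩ := x
  obtain ⟨y, hy, hlim⟩ := mem_closure_iff_seq_limit.1 hx
  refine univRep.isClosed_range.mem_of_tendsto
    (f := fun n => (⟨y n, (key (y n) (hy n)).1⟩ : TCov)) (b := Filter.atTop) ?_
    (Filter.Eventually.of_forall fun n => (key (y n) (hy n)).2)
  exact tendsto_subtype_rng.2 hlim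

/-- `𝒯_cov(X)` is universal for Nica covariant Toeplitz representations of `X`, in C⋆-algebras of
an arbitrary universe. -/
theorem exists_unique_lift {C : Type*} [NonUnitalCStarAlgebra C] (ψ : ToeplitzRep C)
    (h : ψ.IsNicaCovariant) : ∃! π : TCov →⋆ₙₐ[ℂ] C, univRep.comp π = ψ := by
  have := ψ.small_range
  let e : Shrink.{0} ψ.range ≃ ψ.range := (equivShrink ψ.range).symm
  let _ := cstarAlgebraOfEquiv e
  let i : NicaRep := ⟨Shrink.{0} ψ.range, ψ.corestrict.comp (homOfEquiv e),
    h.corestrict.comp (homOfEquiv e)⟩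
  let π₀ : sumRep.range →⋆ₙₐ[ℂ] C :=
    (NonUnitalStarSubalgebraClass.subtype ψ.range).comp ((invOfEquiv e).comp
      ((proj i).comp (NonUnitalStarSubalgebraClass.subtype sumRep.range)))
  let π : TCov →⋆ₙₐ[ℂ] C := π₀
  have hπ : ∀ (m : ℕ+) (ξ : Fib m), π (univRep.toFun m ξ) = ψ.toFun m ξ := by
    intro m ξ
    change ((e (e.symm (ψ.corestrict.toFun m ξ)) : ψ.range) : C) = _
    rw [e.apply_symm_apply]
    rfl
  refine ⟨π, ?_, ?_⟩
  · have ext : ∀ φ ψ : ToeplitzRep C, (∀ m ξ, φ.toFun m ξ = ψ.toFun m ξ) → φ = ψ := by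
      rintro ⟨a, _, _, _, _⟩ ⟨b, _, _, _, _⟩ hab
      obtain rfl : a = b := funext fun m => LinearMap.ext (hab m)
      rfl
    exact ext _ _ hπ
  · intro ρ hρ
    have hρ' : ∀ (m : ℕ+) (ξ : Fib m), ρ (univRep.toFun m ξ) = ψ.toFun m ξ := by
      intro m ξ
      rw [← hρ]
      rfl
    apply NonUnitalStarAlgHom.ext
    intro x
    have c1 : Continuous ρ := AddMonoidHomClass.continuous_of_bound ρ 1 fun x => by
      rw [one_mul]
      exact NonUnitalStarAlgHom.norm_apply_le ρ x
    have c2 : Continuous π := AddMonoidHomClass.continuous_of_bound π 1 fun x => by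
      rw [one_mul]
      exact NonUnitalStarAlgHom.norm_apply_le π x
    refine univRep.induction_range (p := fun x => ρ x = π x) (isClosed_eq c1 c2) ?_ ?_ ?_ ?_ ?_ ?_
      (mem_univRep_range x)
    · intro m ξ
      rw [hρ', hπ]
    · rw [map_zero, map_zero]
    · intro x y hx hy
      rw [map_add, map_add, hx, hy]
    · intro x y hx hy
      rw [map_mul, map_mul, hx, hy]
    · intro c x hx
      rw [map_smul, map_smul, hx]
    · intro x hx
      rw [map_star, map_star, hx]

/-- The element `u = i_1(Z)` of `𝒯_cov(X)`. -/
def uGen : TCov := univRep.toFun 1 ⟨Z⟩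

/-- The element `w_m = i_m(𝟙_m)` of `𝒯_cov(X)`. -/
def wGen (m : ℕ+) : TCov := univRep.toFun m ⟨1⟩

/-- The relations: `u` is a unitary and the `w_m` are isometries such that
`w_{mn} = w_m w_n` and `w_m u = u^m w_m` for all `m, n`, `w_p^* w_q = w_q w_p^*` for distinct
primes `p, q`, and `w_p^* u^k w_p = 0` for a prime `p` and `1 ≤ k < p`. -/
structure Relations {C : Type*} [CStarAlgebra C] (u : C) (w : ℕ+ → C) : Prop where
  unitary_u : u ∈ unitary C
  isometry_w (m : ℕ+) : star (w m) * w m = 1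
  w_mul (m n : ℕ+) : w (m * n) = w m * w n
  w_u (m : ℕ+) : w m * u = u ^ (m : ℕ) * w m
  star_w_w (p q : ℕ+) : (p : ℕ).Prime → (q : ℕ).Prime → p ≠ q →
    star (w p) * w q = w q * star (w p)
  star_w_u_w (p : ℕ+) (k : ℕ) : (p : ℕ).Prime → 1 ≤ k → k < (p : ℕ) →
    star (w p) * u ^ k * w p = 0

end

end NicaToeplitz

namespace NicaToeplitz

noncomputable section

/-! ### The function algebra -/

/-! Everything rests on `i_m(ξ 1_m) = i_1(ξ) w_m`, so a representation of `X` is a unital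
representation of `C(𝕋)`, that is a unitary, together with the images of the `1_m`.

In `𝒯_cov(X)` the inner product gives `w_m^* i_1(f) w_m = i_1(L_m f)`. Hence the `w_m` are
isometries, and (B4) holds because `L_p(Z^k) = 0` when `p ∤ k`. For (B3), `θ_{1,1}` on `X_m` is `α_m
L_m`. For coprime `m, n` the maps `L_m` and `α_n` commute (`transfer_alpha_comm`), so Nica
covariance reads `w_m w_m^* w_n w_n^* = w_{mn} w_{mn}^*`. Multiplying by `w_m^*` on the left and
`w_n` on the right yields `w_m^* w_n = w_n w_m^*`.

Conversely, let `U, W_m` satisfy the relations, let `ρ` be the functional calculus of `U`, and put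
`ψ_m(ξ 1_m) = ρ(ξ) W_m`. The Toeplitz condition is `W_m^* ρ(f) W_m = ρ(L_m f)`
(`star_w_mul_rho_mul_w`), which (B4) gives at primes and multiplicativity elsewhere. Nica covariance
reduces to `P_m P_n P_{m∨n} = P_m P_n` for `P_m = ψ^{(m)}(1)` (`isNicaCovariant_of_rangeProj`). With
`m = d m'`, `n = d n'`, `d = gcd(m, n)`, the middle factor `W_m^* ρ(Z^j) W_n` of a summand of `P_m
P_n` vanishes unless `d ∣ j`. If `d ∣ j`, Bézout for `m', n'` and (B3) move `W_{m'}^*` to the right,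
and the summand ends in the adjoint of an element of `ψ_{m∨n}(X_{m∨n})`, which `P_{m∨n}` fixes
(`mul_rangeProj_lcm`). Universality of `𝒯_cov(X)` then supplies `π`, which is unique because `u` and
the `w_m` generate. -/

theorem Z_apply (z : Circle) : Z z = (z : ℂ) := rfl

theorem star_Z_mul_Z : star Z * Z = 1 := by
  ext z
  simp [Z_apply, ← Circle.coe_inv_eq_conj]

/-- Stone–Weierstrass: `Z` alone separates the points of the circle. -/
theorem topologicalClosure_adjoin_Z :
    (StarAlgebra.adjoin ℂ {Z} : StarSubalgebra ℂ A).topologicalClosure = ⊤ := by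
  apply ContinuousMap.starSubalgebra_topologicalClosure_eq_top_of_separatesPoints
  intro x y hxy
  exact ⟨Z, ⟨Z, StarAlgebra.self_mem_adjoin_singleton ℂ Z, rfl⟩,
    fun h => hxy (Circle.coe_injective h)⟩

/-- A closed property of functions on the circle which is stable under the algebra operations
holds everywhere if it holds for `Z` and for its adjoint. -/
theorem induction_Z {p : A → Prop} (hcl : IsClosed {f | p f}) (hZ : p Z) (hZs : p (star Z))
    (hc : ∀ c : ℂ, p (algebraMap ℂ A c)) (hadd : ∀ f g, p f → p g → p (f + g))
    (hmul : ∀ f g, p f → p g → p (f * g)) (f : A) : p f := by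
  -- Carrying `star g` along means that `p` itself need not be stable under adjoints.
  have key : ∀ g ∈ StarAlgebra.adjoin ℂ {Z}, p g ∧ p (star g) := by
    intro g hg
    induction hg using StarAlgebra.adjoin_induction with
    | mem x hx => obtain rfl := hx; exact ⟨hZ, hZs⟩
    | algebraMap c => exact ⟨hc c, by rw [← algebraMap_star_comm]; exact hc _⟩
    | add x y _ _ hx hy => exact ⟨hadd _ _ hx.1 hy.1, by rw [star_add]; exact hadd _ _ hx.2 hy.2⟩
    | mul x y _ _ hx hy => exact ⟨hmul _ _ hx.1 hy.1, by rw [star_mul]; exact hmul _ _ hy.2 hx.2⟩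
    | star x _ hx => exact ⟨hx.2, by rw [star_star]; exact hx.1⟩
  have hf : f ∈ (StarAlgebra.adjoin ℂ {Z} : StarSubalgebra ℂ A).topologicalClosure := by
    rw [topologicalClosure_adjoin_Z]
    trivial
  exact closure_minimal (fun g hg => (key g hg).1) hcl hf

/-- The function `z ↦ z ^ j` on the circle, for an integer `j`. -/
def zpowZ (j : ℤ) : A := ⟨fun z => ((z ^ j : Circle) : ℂ),
  continuous_subtype_val.comp (continuous_zpow j)⟩

theorem zpowZ_apply (j : ℤ) (z : Circle) : zpowZ j z = ((z ^ j : Circle) : ℂ) := rfl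

theorem zpowZ_natCast (k : ℕ) : zpowZ k = Z ^ k := by
  ext z
  simp [zpowZ_apply, Z_apply]

theorem zpowZ_add (i j : ℤ) : zpowZ (i + j) = zpowZ i * zpowZ j := by
  ext z
  simp [zpowZ_apply, zpow_add]

theorem star_zpowZ (j : ℤ) : star (zpowZ j) = zpowZ (-j) := by
  ext z
  simp [zpowZ_apply, ← Circle.coe_inv_eq_conj]

theorem alpha_zpowZ (m : ℕ+) (j : ℤ) : alpha m (zpowZ j) = zpowZ (m * j) := by
  ext z
  simp [alpha_apply, zpowZ_apply, zpow_mul]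

theorem alpha_Z (m : ℕ+) : alpha m Z = Z ^ (m : ℕ) := by
  ext z
  simp [alpha_apply, Z_apply]

theorem alpha_alpha (m n : ℕ+) (f : A) : alpha m (alpha n f) = alpha (m * n) f := by
  ext z
  simp [alpha_apply, pow_mul]

/-! ### Roots of unity and the transfer operator -/

theorem exists_primitiveRoot (m : ℕ+) : ∃ ω : Circle, IsPrimitiveRoot ω (m : ℕ) := by
  have hm : ((m : ℕ) : ℝ) ≠ 0 := by exact_mod_cast m.ne_zero
  refine ⟨Circle.exp (2 * Real.pi / m), ?_⟩
  have h := Complex.isPrimitiveRoot_exp (m : ℕ) m.ne_zero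
  refine IsPrimitiveRoot.of_map_of_injective (f := Circle.coeHom) ?_ Circle.coe_injective
  convert h using 1
  change ((Circle.exp _ : Circle) : ℂ) = _
  rw [Circle.coe_exp]
  push_cast
  ring_nf

/-- Multiplying one root by the powers of a primitive root of unity produces `m` distinct roots. -/
theorem card_roots (m : ℕ+) (z : Circle) : (roots m z).card = m := by
  refine le_antisymm (card_roots_le m z) ?_
  obtain ⟨ω, hω⟩ := exists_primitiveRoot m
  obtain ⟨v, hv⟩ := exists_root m z
  rw [← Finset.card_range (m : ℕ)]
  refine Finset.card_le_card_of_injOn (fun k => ω ^ k * v) ?_ ?_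
  · intro k _
    change _ ∈ roots m z
    rw [mem_roots, mul_pow, hv, ← pow_mul, mul_comm k, pow_mul, hω.pow_eq_one, one_pow, one_mul]
  · intro i hi j hj h
    exact hω.pow_inj (Finset.mem_range.1 hi) (Finset.mem_range.1 hj) (mul_right_cancel h)

/-- `alpha m f` is constant on each fibre of `w ↦ w ^ m`, and the fibre has exactly `m` points, so
averaging returns `f`. -/
theorem transfer_alpha (m : ℕ+) (f : A) : transfer m (alpha m f) = f := by
  have hm : ((m : ℕ) : ℂ) ≠ 0 := by exact_mod_cast m.ne_zero
  rw [← one_mul (alpha m f), transfer_mul_alpha]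
  convert one_mul f
  ext z
  simp [transfer_apply, card_roots, hm]

theorem transfer_one (m : ℕ+) : transfer m 1 = 1 := by
  simpa using transfer_alpha m 1

/-- Rotating a fibre by a primitive `m`-th root of unity `ω` permutes it and multiplies the sum by
`ω ^ j ≠ 1`. This is the source of (B4). -/
theorem transfer_zpowZ_of_not_dvd {m : ℕ+} {j : ℤ} (h : ¬ (m : ℤ) ∣ j) :
    transfer m (zpowZ j) = 0 := by
  obtain ⟨ω, hω⟩ := exists_primitiveRoot m
  have h1 : ((ω ^ j : Circle) : ℂ) ≠ 1 := by
    intro h1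
    apply h
    rw [← hω.zpow_eq_one_iff_dvd]
    exact Circle.coe_injective (by simpa using h1)
  ext z
  have h2 : transfer m (zpowZ j) z = ((ω ^ j : Circle) : ℂ) * transfer m (zpowZ j) z := by
    simp only [transfer_apply]
    rw [mul_left_comm]
    congr 1
    rw [Finset.mul_sum]
    refine Finset.sum_bij' (fun w _ => ω⁻¹ * w) (fun w _ => ω * w) ?_ ?_ ?_ ?_ ?_
    · intro w hw
      rw [mem_roots] at hw ⊢
      rw [mul_pow, hw, inv_pow, hω.pow_eq_one, inv_one, one_mul]
    · intro w hw
      rw [mem_roots] at hw ⊢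
      rw [mul_pow, hw, hω.pow_eq_one, one_mul]
    · simp
    · simp
    · intro w _
      rw [zpowZ_apply, zpowZ_apply, ← Circle.coe_mul, ← mul_zpow, mul_inv_cancel_left]
  have h3 : (1 - ((ω ^ j : Circle) : ℂ)) * transfer m (zpowZ j) z = 0 := by
    rw [sub_mul, one_mul, ← h2, sub_self]
  exact (mul_eq_zero.1 h3).resolve_left (sub_ne_zero.2 h1.symm)

-- For coprime `m, n`, the map `w ↦ w ^ n` is a bijection from the `m`-th roots of `z` onto those of
-- `z ^ n`: it is injective because a common `m`-th and `n`-th root of unity is `1`, and both sets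
-- have `m` elements. This is the source of (B3).
open Classical in
theorem transfer_alpha_comm {m n : ℕ+} (h : (m : ℕ).Coprime n) (f : A) :
    transfer m (alpha n f) = alpha n (transfer m f) := by
  ext z
  simp only [transfer_apply, alpha_apply]
  congr 1
  have hinj : Set.InjOn (fun w : Circle => w ^ (n : ℕ)) (roots m z) := by
    intro v hv w hw hvw
    have hv' := mem_roots.1 hv
    have hw' := mem_roots.1 hw
    have h1 : (v * w⁻¹) ^ (m : ℕ) = 1 := by rw [mul_pow, inv_pow, hv', hw', mul_inv_cancel]
    have h2 : (v * w⁻¹) ^ (n : ℕ) = 1 := by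
      have : v ^ (n : ℕ) = w ^ (n : ℕ) := hvw
      rw [mul_pow, inv_pow, this, mul_inv_cancel]
    have h3 := (pow_gcd_eq_one (a := v * w⁻¹) (m := (m : ℕ)) (n := (n : ℕ))).2 ⟨h1, h2⟩
    rw [h, pow_one] at h3
    exact mul_inv_eq_one.1 h3
  have himg : Finset.image (fun w : Circle => w ^ (n : ℕ)) (roots m z) =
      roots m (z ^ (n : ℕ)) := by
    refine Finset.eq_of_subset_of_card_le ?_ ?_
    · intro w hw
      obtain ⟨v, hv, rfl⟩ := Finset.mem_image.1 hw
      rw [mem_roots] at hv ⊢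
      rw [← hv, ← pow_mul, ← pow_mul, mul_comm]
    · rw [Finset.card_image_of_injOn hinj, card_roots, card_roots]
  rw [← himg, Finset.sum_image hinj]

theorem reconstruction_fn (m : ℕ+) (f : A) :
    ∑ k ∈ Finset.range m, Z ^ k * alpha m (transfer m (star (Z ^ k) * f)) = f := by
  have h := congrArg (fibCLE m) (reconstruction (⟨f⟩ : Fib m))
  rwa [map_sum] at h

theorem continuous_alpha (m : ℕ+) : Continuous (alpha m) :=
  ContinuousMap.continuous_precomp _

/-! ### The relations in the Nica-Toeplitz algebra -/

namespace ToeplitzRep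

variable {C : Type*} [NonUnitalCStarAlgebra C] (ψ : ToeplitzRep C)

/-- Indices such as `m.lcm n` and `m * n` agree only propositionally, so elements of their fibres
are compared through the underlying functions. -/
theorem toFun_eq_of_fn {m n : ℕ+} (h : m = n) {ξ : Fib m} {η : Fib n} (h' : ξ.fn = η.fn) :
    ψ.toFun m ξ = ψ.toFun n η := by
  subst h
  rw [Fib.ext h']

theorem toFun_eq_base_mul {m : ℕ+} (ξ : Fib m) :
    ψ.toFun m ξ = ψ.base ξ.fn * ψ.toFun m ⟨1⟩ := by
  rw [map_leftAct]
  congr 1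
  ext1
  simp [leftAct]

theorem toFun_one_mul_base (m : ℕ+) (f : A) :
    ψ.toFun m ⟨1⟩ * ψ.base f = ψ.base (alpha m f) * ψ.toFun m ⟨1⟩ := by
  rw [← map_act, map_leftAct]
  congr 1
  ext1
  simp [leftAct]

theorem star_toFun_one_mul (m : ℕ+) (f : A) :
    star (ψ.toFun m ⟨1⟩) * ψ.toFun m ⟨f⟩ = ψ.base (transfer m f) := by
  rw [star_mul_toFun, base_apply, inner_def]
  simp

end ToeplitzRep

/-- On functions `θ_{1,1}` is `α_m L_m`, and `α_m L_m α_n L_n = α_m α_n L_m L_n = α_{mn} L_{mn}` by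
coprimality. -/
theorem alignedProd_theta_one {m n : ℕ+} (h : (m : ℕ).Coprime n) :
    alignedProd (thetaK (⟨1⟩ : Fib m) ⟨1⟩) (thetaK (⟨1⟩ : Fib n) ⟨1⟩) =
      thetaK (⟨1⟩ : Fib (m.lcm n)) ⟨1⟩ := by
  have hl : m.lcm n = m * n := PNat.eq (by simpa using h.lcm_eq_mul)
  apply Subtype.ext
  ext1 ζ
  ext1
  change (theta (⟨1⟩ : Fib m) ⟨1⟩ ⟨(theta (⟨1⟩ : Fib n) ⟨1⟩ ⟨ζ.fn⟩).fn⟩).fn = _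
  change _ = (theta (⟨1⟩ : Fib (m.lcm n)) ⟨1⟩ ζ).fn
  simp only [theta_apply, fn_act, inner_def, star_one, one_mul]
  rw [transfer_alpha_comm h, alpha_alpha, transfer_transfer, mul_comm n m, ← hl]

/-- The unital homomorphism `i_1`. -/
def univBase : A →⋆ₐ[ℂ] TCov where
  toFun := univRep.base
  -- The unit of `TCov` was defined to be `i_1(1)`.
  map_one' := rfl
  map_mul' := _root_.map_mul univRep.base
  map_zero' := _root_.map_zero univRep.base
  map_add' := _root_.map_add univRep.base
  commutes' c := by
    rw [Algebra.algebraMap_eq_smul_one, Algebra.algebraMap_eq_smul_one, _root_.map_smul]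
    rfl
  map_star' := map_star univRep.base

theorem univBase_Z : univBase Z = uGen := rfl

theorem continuous_univBase : Continuous univBase :=
  AddMonoidHomClass.continuous_of_bound univBase 1 fun f => by
    rw [one_mul]
    exact NonUnitalStarAlgHom.norm_apply_le univBase f

theorem univRep_eq {m : ℕ+} (ξ : Fib m) : univRep.toFun m ξ = univBase ξ.fn * wGen m :=
  univRep.toFun_eq_base_mul ξ

theorem star_wGen_mul_wGen (m : ℕ+) : star (wGen m) * wGen m = 1 := by
  have h := univRep.star_toFun_one_mul m 1
  rw [transfer_one] at h
  exact h

theorem wGen_mul (m n : ℕ+) : wGen (m * n) = wGen m * wGen n := by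
  rw [wGen, wGen, wGen, univRep.toFun_mul]
  congr 1
  ext1
  simp [fn_mul]

/-- Nica covariance for the operators `θ_{1,1}` says that the range projections of `w_m` and `w_n`
multiply to that of `w_{mn}`. Compressing by `w_m^*` and `w_n` turns this into the commutation
relation. -/
theorem star_wGen_mul_wGen_comm {m n : ℕ+} (h : (m : ℕ).Coprime n) :
    star (wGen m) * wGen n = wGen n * star (wGen m) := by
  have hl : m.lcm n = m * n := PNat.eq (by simpa using h.lcm_eq_mul)
  have key : wGen m * star (wGen m) * (wGen n * star (wGen n)) =
      wGen (m * n) * star (wGen (m * n)) := by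
    have h1 := (ToeplitzRep.isNicaCovariant_iff _).1 univRep_cov m n
      (thetaK (⟨1⟩ : Fib m) ⟨1⟩) (thetaK (⟨1⟩ : Fib n) ⟨1⟩)
    rw [alignedProd_theta_one h, ToeplitzRep.pimsner_theta, ToeplitzRep.pimsner_theta,
      ToeplitzRep.pimsner_theta,
      univRep.toFun_eq_of_fn hl (η := (⟨1⟩ : Fib (m * n))) rfl] at h1
    exact h1
  have e1 : star (wGen m) * wGen n =
      star (wGen m) * (wGen m * star (wGen m) * (wGen n * star (wGen n))) * wGen n := by
    have hm := star_wGen_mul_wGen m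
    have hn := star_wGen_mul_wGen n
    calc star (wGen m) * wGen n
        = (star (wGen m) * wGen m) * star (wGen m) * wGen n * (star (wGen n) * wGen n) := by
          rw [hm, hn, one_mul, mul_one]
      _ = _ := by simp only [mul_assoc]
  rw [e1, key]
  calc star (wGen m) * (wGen (m * n) * star (wGen (m * n))) * wGen n
      = star (wGen m) * wGen m * wGen n * star (wGen m) * (star (wGen n) * wGen n) := by
        rw [wGen_mul m n]
        -- `w_m` and `w_n` commute since `mn = nm`; in this order of the adjoints, `w_n^*` meets the
        -- final `w_n` and cancels.
        have : star (wGen m * wGen n) = star (wGen m) * star (wGen n) := by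
          rw [← wGen_mul, mul_comm m n, wGen_mul, star_mul]
        rw [this]
        simp only [mul_assoc]
    _ = _ := by rw [star_wGen_mul_wGen, star_wGen_mul_wGen, one_mul, mul_one]

theorem relations_gen : Relations uGen wGen where
  unitary_u := by
    rw [← univBase_Z, Unitary.mem_iff, ← map_star, ← _root_.map_mul, ← _root_.map_mul,
      star_Z_mul_Z, mul_comm, star_Z_mul_Z, map_one]
    exact ⟨rfl, rfl⟩
  isometry_w := star_wGen_mul_wGen
  w_mul := wGen_mul
  w_u m := by
    rw [← univBase_Z, ← map_pow, ← alpha_Z]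
    exact univRep.toFun_one_mul_base m Z
  star_w_w p q hp hq hpq := star_wGen_mul_wGen_comm
    ((Nat.coprime_primes hp hq).2 fun h => hpq (PNat.eq h))
  star_w_u_w p k _ h1 h2 := by
    have h3 : ¬ ((p : ℕ) : ℤ) ∣ (k : ℤ) := by
      rw [Int.natCast_dvd_natCast]
      exact Nat.not_dvd_of_pos_of_lt h1 h2
    have h4 := univRep.star_toFun_one_mul p (Z ^ k)
    have h5 : univRep.toFun p ⟨Z ^ k⟩ = uGen ^ k * wGen p := by
      rw [univRep_eq, map_pow, univBase_Z]
    rw [h5, ← zpowZ_natCast, transfer_zpowZ_of_not_dvd h3, _root_.map_zero] at h4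
    rw [mul_assoc]
    exact h4

theorem topologicalClosure_adjoin_gen :
    (StarAlgebra.adjoin ℂ (insert uGen (Set.range wGen))).topologicalClosure = ⊤ := by
  set B := (StarAlgebra.adjoin ℂ (insert uGen (Set.range wGen))).topologicalClosure with hB
  have hsub : insert uGen (Set.range wGen) ⊆ (B : Set TCov) :=
    (StarAlgebra.subset_adjoin ℂ _).trans (StarSubalgebra.le_topologicalClosure _)
  have hcl : IsClosed (B : Set TCov) := StarSubalgebra.isClosed_topologicalClosure _
  have hu : uGen ∈ B := hsub (Set.mem_insert _ _)
  have hw : ∀ m, wGen m ∈ B := fun m => hsub (Set.mem_insert_of_mem _ ⟨m, rfl⟩)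
  have hbase : ∀ f, univBase f ∈ B := by
    refine induction_Z (hcl.preimage continuous_univBase) hu ?_ ?_ ?_ ?_
    · rw [map_star]
      exact star_mem hu
    · intro c
      rw [AlgHomClass.commutes]
      exact algebraMap_mem B c
    · intro f g hf hg
      rw [map_add]
      exact add_mem hf hg
    · intro f g hf hg
      rw [_root_.map_mul]
      exact mul_mem hf hg
  rw [eq_top_iff]
  intro x _
  refine univRep.induction_range (p := fun x => x ∈ B) hcl ?_ (zero_mem B) (fun _ _ => add_mem)
    (fun _ _ => mul_mem) (fun c _ h => B.toSubalgebra.smul_mem h c) (fun _ => star_mem)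
    (mem_univRep_range x)
  intro m ξ
  rw [univRep_eq]
  exact mul_mem (hbase _) (hw m)

/-! ### A criterion for Nica covariance -/

namespace ToeplitzRep

variable {C : Type*} [NonUnitalCStarAlgebra C] (ψ : ToeplitzRep C)

/-- The projection `ψ^{(m)}(1)`. -/
def rangeProj (m : ℕ+) : C :=
  ∑ k ∈ Finset.range m, ψ.toFun m ⟨Z ^ k⟩ * star (ψ.toFun m ⟨Z ^ k⟩)

theorem star_rangeProj (m : ℕ+) : star (ψ.rangeProj m) = ψ.rangeProj m := by
  simp [rangeProj, star_sum]

theorem pimsner_mul_toFun {m : ℕ+} (T : Compact m) (ζ : Fib m) :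
    ψ.pimsner m T * ψ.toFun m ζ = ψ.toFun m (T.1 ζ) := by
  conv_rhs => rw [← reconstruction ζ, map_sum, map_sum]
  rw [pimsner_apply, Finset.sum_mul]
  refine Finset.sum_congr rfl fun k _ => ?_
  rw [mul_assoc, star_mul_toFun, ← base_apply, ← map_act, theta_apply,
    (mem_compact_iff _).1 T.2]

theorem rangeProj_mul_toFun {m : ℕ+} (ζ : Fib m) :
    ψ.rangeProj m * ψ.toFun m ζ = ψ.toFun m ζ := by
  conv_rhs => rw [← reconstruction ζ, map_sum]
  rw [rangeProj, Finset.sum_mul]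
  refine Finset.sum_congr rfl fun k _ => ?_
  rw [mul_assoc, star_mul_toFun, ← base_apply, ← map_act, theta_apply]

theorem star_toFun_mul_rangeProj {m : ℕ+} (ζ : Fib m) :
    star (ψ.toFun m ζ) * ψ.rangeProj m = star (ψ.toFun m ζ) := by
  rw [← star_rangeProj, ← star_mul, rangeProj_mul_toFun]

theorem rangeProj_mul_pimsner {m : ℕ+} (T : Compact m) :
    ψ.rangeProj m * ψ.pimsner m T = ψ.pimsner m T := by
  rw [pimsner_apply, Finset.mul_sum]
  exact Finset.sum_congr rfl fun k _ => by rw [← mul_assoc, rangeProj_mul_toFun]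

theorem pimsner_mul_rangeProj {m : ℕ+} (T : Compact m) :
    ψ.pimsner m T * ψ.rangeProj m = ψ.pimsner m T := by
  rw [pimsner_apply, Finset.sum_mul]
  exact Finset.sum_congr rfl fun k _ => by rw [mul_assoc, star_toFun_mul_rangeProj]

/-- An element `y` with `y P_m = y` is determined by its action on `ψ_m(X_m)`, since `P_m` is a sum
of terms `ψ_m(ξ) ψ_m(ξ)^*`. -/
theorem eq_pimsner {m : ℕ+} {y : C} (T : Compact m) (h1 : y * ψ.rangeProj m = y)
    (h2 : ∀ ζ : Fib m, y * ψ.toFun m ζ = ψ.toFun m (T.1 ζ)) : y = ψ.pimsner m T := by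
  rw [← h1, rangeProj, Finset.mul_sum, pimsner_apply]
  exact Finset.sum_congr rfl fun k _ => by rw [← mul_assoc, h2]

theorem pimsner_mul_toFun_of_dvd {m r : ℕ+} (h : m ∣ r) (T : Compact m) (ζ : Fib r) :
    ψ.pimsner m T * ψ.toFun r ζ = ψ.toFun r (amp m r T.1 ζ) := by
  obtain ⟨k, rfl⟩ := h
  -- Every element of `X_{mk}` factors as `(f 1_m)(1 1_k)`, so `T` only meets the first factor.
  have e : ∀ f : A, ψ.toFun (m * k) ⟨f⟩ = ψ.toFun m ⟨f⟩ * ψ.toFun k ⟨1⟩ := by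
    intro f
    rw [toFun_mul]
    congr 1
    ext1
    simp [fn_mul]
  calc ψ.pimsner m T * ψ.toFun (m * k) ζ
      = ψ.pimsner m T * ψ.toFun m ⟨ζ.fn⟩ * ψ.toFun k ⟨1⟩ := by rw [mul_assoc, ← e]
    _ = ψ.toFun m (T.1 ⟨ζ.fn⟩) * ψ.toFun k ⟨1⟩ := by rw [pimsner_mul_toFun]
    _ = ψ.toFun (m * k) (amp m (m * k) T.1 ζ) := (e (T.1 ⟨ζ.fn⟩).fn).symm

theorem rangeProj_mul_pimsner_mul_rangeProj {m r : ℕ+} (h : m ∣ r) (T : Compact m) :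
    ψ.rangeProj r * (ψ.pimsner m T * ψ.rangeProj r) = ψ.pimsner m T * ψ.rangeProj r := by
  have e : ψ.pimsner m T * ψ.rangeProj r = ∑ k ∈ Finset.range r,
      ψ.toFun r (amp m r T.1 ⟨Z ^ k⟩) * star (ψ.toFun r ⟨Z ^ k⟩) := by
    rw [rangeProj, Finset.mul_sum]
    exact Finset.sum_congr rfl fun k _ => by rw [← mul_assoc, pimsner_mul_toFun_of_dvd ψ h]
  rw [e, Finset.mul_sum]
  exact Finset.sum_congr rfl fun k _ => by rw [← mul_assoc, rangeProj_mul_toFun]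

/-- By the preceding lemma `ψ^{(m)}(T)` leaves the range of the projection `P_r` invariant. The same
holds for its adjoint, and the two together give commutation. Splitting `T` into rank-one operators
makes adjoints explicit: `θ_{ξ,η}^* = θ_{η,ξ}`. -/
theorem rangeProj_commute_pimsner {m r : ℕ+} (h : m ∣ r) (T : Compact m) :
    ψ.rangeProj r * ψ.pimsner m T = ψ.pimsner m T * ψ.rangeProj r := by
  rw [eq_sum_theta T, map_sum, Finset.mul_sum, Finset.sum_mul]
  refine Finset.sum_congr rfl fun k _ => ?_
  have hs : ∀ ξ η : Fib m, star (ψ.pimsner m (thetaK ξ η)) = ψ.pimsner m (thetaK η ξ) := by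
    intro ξ η
    rw [pimsner_theta, pimsner_theta, star_mul, star_star]
  have h1 := ψ.rangeProj_mul_pimsner_mul_rangeProj h (thetaK (T.1 ⟨Z ^ k⟩) ⟨Z ^ k⟩)
  have h2 := congrArg star
    (ψ.rangeProj_mul_pimsner_mul_rangeProj h (thetaK ⟨Z ^ k⟩ (T.1 ⟨Z ^ k⟩)))
  simp only [star_mul, star_rangeProj, hs] at h2
  rw [← h1, ← h2, mul_assoc]

/-- Both sides of the covariance identity act alike on `ψ_{m∨n}(X_{m∨n})` for every Toeplitz
representation. What remains is that `P_{m∨n}` is absorbed on the right by `ψ^{(m)}(S) ψ^{(n)}(T)`;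
it commutes past `ψ^{(n)}(T)`, and the hypothesis absorbs it into `P_m P_n`. -/
theorem isNicaCovariant_of_rangeProj
    (h : ∀ m n : ℕ+, ψ.rangeProj m * ψ.rangeProj n * ψ.rangeProj (m.lcm n) =
      ψ.rangeProj m * ψ.rangeProj n) : ψ.IsNicaCovariant := by
  rw [isNicaCovariant_iff]
  intro m n S T
  have hm := PNat.dvd_lcm_left m n
  have hn := PNat.dvd_lcm_right m n
  refine ψ.eq_pimsner _ ?_ fun ζ => ?_
  · have e : ψ.pimsner m S * ψ.pimsner n T =
        ψ.pimsner m S * (ψ.rangeProj m * ψ.rangeProj n) * ψ.pimsner n T := by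
      rw [← mul_assoc, pimsner_mul_rangeProj, mul_assoc, rangeProj_mul_pimsner]
    rw [e, mul_assoc, ← rangeProj_commute_pimsner ψ hn, ← mul_assoc,
      mul_assoc (ψ.pimsner m S), h]
  · rw [mul_assoc, pimsner_mul_toFun_of_dvd ψ hn, pimsner_mul_toFun_of_dvd ψ hm]
    rfl

end ToeplitzRep

/-! ### The representation defined by a unitary and isometries -/

theorem pnat_induction_mul {p : ℕ+ → Prop} (h1 : p 1) (hp : ∀ q : ℕ+, (q : ℕ).Prime → p q)
    (hmul : ∀ m n, p m → p n → p (m * n)) (n : ℕ+) : p n := by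
  have key : ∀ (k : ℕ) (hk : 0 < k), p ⟨k, hk⟩ := by
    intro k
    induction k using Nat.recOnMul with
    | zero => exact fun h => absurd h (lt_irrefl _)
    | one => exact fun _ => h1
    | prime q hq => exact fun h => hp ⟨q, h⟩ hq
    | mul a b ha hb =>
      intro h
      have ha0 : 0 < a := Nat.pos_of_mul_pos_right h
      have hb0 : 0 < b := Nat.pos_of_mul_pos_left h
      exact hmul _ _ (ha ha0) (hb hb0)
  exact key n n.pos

variable {C : Type*} [CStarAlgebra C]

/-- The unital homomorphism `C(𝕋) → C` sending `Z` to a given unitary. -/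
def unitaryHom {U : C} (hU : U ∈ unitary C) : A →⋆ₐ[ℂ] C :=
  have : IsStarNormal U := isStarNormal_of_mem_unitary hU
  (cfcHom (R := ℂ) this).comp (ContinuousMap.compStarAlgHom' ℂ ℂ
    ⟨fun x : spectrum ℂ U => (⟨x, spectrum.subset_circle_of_unitary hU x.2⟩ : Circle),
      Continuous.subtype_mk continuous_subtype_val _⟩)

theorem unitaryHom_Z {U : C} (hU : U ∈ unitary C) : unitaryHom hU Z = U :=
  have : IsStarNormal U := isStarNormal_of_mem_unitary hU
  cfcHom_id (R := ℂ) this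

theorem continuous_unitaryHom {U : C} (hU : U ∈ unitary C) : Continuous (unitaryHom hU) :=
  AddMonoidHomClass.continuous_of_bound (unitaryHom hU) 1 fun f => by
    rw [one_mul]
    exact NonUnitalStarAlgHom.norm_apply_le (unitaryHom hU) f

namespace Relations

variable {U : C} {W : ℕ+ → C} (h : Relations U W)

/-- The homomorphism `C(𝕋) → C` given by the unitary `U`. -/
def rho : A →⋆ₐ[ℂ] C := unitaryHom h.unitary_u

theorem rho_Z : h.rho Z = U := unitaryHom_Z _

theorem continuous_rho : Continuous h.rho := continuous_unitaryHom _

-- `W 1` is an idempotent isometry.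
include h in
theorem w_one : W 1 = 1 := by
  have h1 := h.w_mul 1 1
  rw [one_mul] at h1
  have h2 := h.isometry_w 1
  calc W 1 = star (W 1) * W 1 * W 1 := by rw [h2, one_mul]
    _ = 1 := by rw [mul_assoc, ← h1, h2]

theorem w_mul_rho (m : ℕ+) (f : A) : W m * h.rho f = h.rho (alpha m f) * W m := by
  have hc := h.continuous_rho
  have ha := continuous_alpha m
  refine induction_Z (p := fun f => W m * h.rho f = h.rho (alpha m f) * W m)
    (isClosed_eq (by fun_prop) (by fun_prop)) ?_ ?_ ?_ ?_ ?_ f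
  · rw [alpha_Z, map_pow, rho_Z, h.w_u]
  · have hU := Unitary.mem_iff.1 h.unitary_u
    have hUm := Unitary.mem_iff.1 (pow_mem h.unitary_u (m : ℕ))
    rw [map_star, map_star, map_star, alpha_Z, map_pow, rho_Z]
    calc W m * star U = star (U ^ (m : ℕ)) * U ^ (m : ℕ) * W m * star U := by
          rw [hUm.1, one_mul]
      _ = star (U ^ (m : ℕ)) * (W m * U) * star U := by
          rw [h.w_u]
          simp only [mul_assoc]
      _ = star (U ^ (m : ℕ)) * W m := by
          simp only [mul_assoc]
          rw [hU.2, mul_one]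
  · intro c
    rw [AlgHomClass.commutes, AlgHomClass.commutes, AlgHomClass.commutes, Algebra.commutes]
  · intro f g hf hg
    rw [map_add, map_add, map_add, mul_add, add_mul, hf, hg]
  · intro f g hf hg
    rw [_root_.map_mul, _root_.map_mul, _root_.map_mul, ← mul_assoc, hf, mul_assoc, hg, mul_assoc]

/-- At a prime `p`, expand `f = ∑ Z^k α_p(L_p(Z^{-k} f))`; each `α_p` moves past `W_p`, and (B4)
kills all terms but `k = 0`. The identity passes to products because `L_n L_m = L_{mn}`. -/
theorem star_w_mul_rho_mul_w (m : ℕ+) (f : A) :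
    star (W m) * h.rho f * W m = h.rho (transfer m f) := by
  induction m using pnat_induction_mul generalizing f with
  | h1 =>
    have : transfer 1 f = f := by
      have : alpha 1 f = f := by
        ext z
        simp [alpha_apply]
      conv_lhs => rw [← this, transfer_alpha]
    rw [h.w_one, star_one, one_mul, mul_one, this]
  | hp p hp =>
    conv_lhs => rw [← reconstruction_fn p f]
    rw [map_sum, Finset.mul_sum, Finset.sum_mul, Finset.sum_eq_single_of_mem 0]
    · rw [pow_zero, star_one, one_mul, one_mul, mul_assoc, ← w_mul_rho, ← mul_assoc,
        h.isometry_w, one_mul]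
    · exact Finset.mem_range.2 p.pos
    · intro k hk hk0
      rw [_root_.map_mul, mul_assoc, mul_assoc, ← w_mul_rho, map_pow, rho_Z, ← mul_assoc,
        ← mul_assoc, h.star_w_u_w p k hp (Nat.one_le_iff_ne_zero.2 hk0) (Finset.mem_range.1 hk),
        zero_mul]
  | hmul m n hm hn =>
    rw [← transfer_transfer, ← hn, ← hm, h.w_mul, star_mul]
    simp only [mul_assoc]

include h in
theorem star_w_mul_w {m n : ℕ+} (hmn : (m : ℕ).Coprime n) :
    star (W m) * W n = W n * star (W m) := by
  induction m using pnat_induction_mul with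
  | h1 => rw [h.w_one, star_one, one_mul, mul_one]
  | hp p hp =>
    induction n using pnat_induction_mul with
    | h1 => rw [h.w_one, one_mul, mul_one]
    | hp q hq =>
      refine h.star_w_w p q hp hq ?_
      rintro rfl
      exact (Nat.coprime_primes hp hp).1 hmn rfl
    | hmul a b ha hb =>
      rw [PNat.mul_coe, Nat.coprime_mul_iff_right] at hmn
      rw [h.w_mul, ← mul_assoc, ha hmn.1, mul_assoc, hb hmn.2, mul_assoc]
  | hmul a b ha hb =>
    rw [PNat.mul_coe, Nat.coprime_mul_iff_left] at hmn
    rw [h.w_mul, star_mul, mul_assoc, ha hmn.1, ← mul_assoc, hb hmn.2, mul_assoc]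

/-- The Toeplitz representation `ψ_m(ξ 𝟙_m) = ρ(ξ) W_m`. -/
def rep : ToeplitzRep C where
  toFun m :=
    { toFun := fun ξ => h.rho ξ.fn * W m
      map_add' := fun ξ η => by rw [fn_add, map_add, add_mul]
      map_smul' := fun c ξ => by rw [fn_smul, map_smul, smul_mul_assoc, RingHom.id_apply] }
  base_mul f g := by simp [h.w_one]
  base_star f := by simp [h.w_one, map_star]
  toFun_mul m n ξ η := by
    change h.rho ξ.fn * W m * (h.rho η.fn * W n) = h.rho (ξ.fn * alpha m η.fn) * W (m * n)
    rw [_root_.map_mul, h.w_mul, ← mul_assoc, mul_assoc _ (W m), w_mul_rho]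
    simp only [mul_assoc]
  star_mul_toFun m ξ η := by
    change star (h.rho ξ.fn * W m) * (h.rho η.fn * W m) = h.rho (transfer m _) * W 1
    rw [h.w_one, mul_one, ← star_w_mul_rho_mul_w, star_mul, ← map_star, _root_.map_mul]
    simp only [mul_assoc]

theorem rep_toFun {m : ℕ+} (ξ : Fib m) : h.rep.toFun m ξ = h.rho ξ.fn * W m := rfl

/-! ### Nica covariance of the representation -/

theorem star_rho_mul_w_mul_rangeProj (r : ℕ+) (f : A) :
    star (h.rho f * W r) * h.rep.rangeProj r = star (h.rho f * W r) :=
  h.rep.star_toFun_mul_rangeProj (⟨f⟩ : Fib r)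

/-- By Bézout `j = m a + n b`, so `Z^j = α_m(Z^a) α_n(Z^b)`: the first factor leaves to the left
through `W_m^*`, the second to the right through `W_n`, and then `W_m^*` and `W_n` commute. -/
theorem star_w_mul_rho_zpowZ_mul_w {m n : ℕ+} (hmn : (m : ℕ).Coprime n) (j : ℤ) :
    ∃ a b : ℤ, star (W m) * h.rho (zpowZ j) * W n =
      h.rho (zpowZ a) * W n * star (W m) * h.rho (zpowZ b) := by
  have hb := Nat.gcd_eq_gcd_ab m n
  rw [hmn] at hb
  refine ⟨Nat.gcdA m n * j, Nat.gcdB m n * j, ?_⟩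
  have e : zpowZ j = alpha m (zpowZ (Nat.gcdA m n * j)) * alpha n (zpowZ (Nat.gcdB m n * j)) := by
    rw [alpha_zpowZ, alpha_zpowZ, ← zpowZ_add]
    congr 1
    rw [← mul_assoc, ← mul_assoc, ← add_mul]
    push_cast at hb ⊢
    rw [← hb, one_mul]
  have hs : ∀ f : A, star (W m) * h.rho (alpha m f) = h.rho f * star (W m) := by
    intro f
    have h1 := congrArg star (h.w_mul_rho m (star f))
    simpa only [star_mul, map_star, star_star] using h1.symm
  rw [e, _root_.map_mul, ← mul_assoc, hs, mul_assoc, ← w_mul_rho, ← mul_assoc,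
    mul_assoc _ (star (W m)), h.star_w_mul_w hmn]
  simp only [mul_assoc]

/-- The left-hand factor is the tail of a summand of `P_m P_n`. It is either zero or ends in the
adjoint of an element of `ψ_{m∨n}(X_{m∨n})`, which `P_{m∨n}` fixes. -/
theorem mul_rangeProj_lcm (m n : ℕ+) (j : ℤ) (f : A) :
    star (W m) * h.rho (zpowZ j) * W n * star (h.rho f * W n) * h.rep.rangeProj (m.lcm n) =
      star (W m) * h.rho (zpowZ j) * W n * star (h.rho f * W n) := by
  obtain ⟨d, m', n', hcop, rfl, rfl⟩ : ∃ d m' n' : ℕ+, (m' : ℕ).Coprime n' ∧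
      m = d * m' ∧ n = d * n' := by
    obtain ⟨m', hm⟩ := PNat.gcd_dvd_left m n
    obtain ⟨n', hn⟩ := PNat.gcd_dvd_right m n
    refine ⟨m.gcd n, m', n', ?_, hm, hn⟩
    have h1 : (m.gcd n : ℕ) * Nat.gcd m' n' = (m.gcd n : ℕ) * 1 := by
      rw [← Nat.gcd_mul_left, ← PNat.mul_coe, ← PNat.mul_coe, ← hm, ← hn, PNat.gcd_coe, mul_one]
    exact Nat.eq_of_mul_eq_mul_left (m.gcd n).pos h1
  -- The lcm is written as `n m'` because `W_{m'}^*` will be joined to `W_n^*` on its right.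
  have hl : (d * m').lcm (d * n') = d * n' * m' := by
    apply PNat.eq
    rw [PNat.lcm_coe, PNat.mul_coe, PNat.mul_coe, PNat.mul_coe, PNat.mul_coe, Nat.lcm_mul_left,
      hcop.lcm_eq_mul]
    ring
  have e : star (W (d * m')) * h.rho (zpowZ j) * W (d * n') =
      star (W m') * h.rho (transfer d (zpowZ j)) * W n' := by
    rw [← star_w_mul_rho_mul_w, h.w_mul, h.w_mul, star_mul]
    simp only [mul_assoc]
  rw [e, hl]
  by_cases hd : (d : ℤ) ∣ j
  · obtain ⟨i, rfl⟩ := hd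
    obtain ⟨a, b, hab⟩ := h.star_w_mul_rho_zpowZ_mul_w hcop i
    -- The adjoint of `ρ(f) W_n ρ(Z^{-b}) W_{m'} = ρ(f α_n(Z^{-b})) W_{n m'}`.
    have e2 : star (W m') * h.rho (zpowZ b) * star (h.rho f * W (d * n')) =
        star (h.rho (f * alpha (d * n') (star (zpowZ b))) * W (d * n' * m')) := by
      rw [h.w_mul (d * n') m', _root_.map_mul, ← mul_assoc, mul_assoc (h.rho f), ← w_mul_rho]
      simp only [star_mul, map_star, star_star, mul_assoc]
    rw [← alpha_zpowZ, transfer_alpha, hab]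
    have e3 : h.rho (zpowZ a) * W n' * star (W m') * h.rho (zpowZ b) *
        star (h.rho f * W (d * n')) = h.rho (zpowZ a) * W n' *
        (star (W m') * h.rho (zpowZ b) * star (h.rho f * W (d * n'))) := by
      simp only [mul_assoc]
    rw [e3, e2, mul_assoc, star_rho_mul_w_mul_rangeProj]
  · rw [transfer_zpowZ_of_not_dvd hd]
    simp

theorem rep_isNicaCovariant : h.rep.IsNicaCovariant := by
  refine h.rep.isNicaCovariant_of_rangeProj fun m n => ?_
  rw [ToeplitzRep.rangeProj, ToeplitzRep.rangeProj, Finset.sum_mul_sum, Finset.sum_mul]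
  refine Finset.sum_congr rfl fun k _ => ?_
  rw [Finset.sum_mul]
  refine Finset.sum_congr rfl fun l _ => ?_
  simp only [rep_toFun]
  -- The `(k, l)` summand of `P_m P_n` has `W_m^* ρ(Z^{l-k}) W_n` in its middle; the exponent may be
  -- negative.
  have e : h.rho (Z ^ k) * W m * star (h.rho (Z ^ k) * W m) *
      (h.rho (Z ^ l) * W n * star (h.rho (Z ^ l) * W n)) = h.rho (Z ^ k) * W m *
      (star (W m) * h.rho (zpowZ (-k + l)) * W n * star (h.rho (Z ^ l) * W n)) := by
    rw [zpowZ_add, ← star_zpowZ, zpowZ_natCast, zpowZ_natCast, _root_.map_mul, map_star,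
      star_mul (h.rho (Z ^ k)) (W m)]
    simp only [mul_assoc]
  rw [e, mul_assoc, mul_rangeProj_lcm]

end Relations

/-! ### The universal property -/

theorem starAlgHom_ext_gen {π σ : TCov →⋆ₐ[ℂ] C} (hu : π uGen = σ uGen)
    (hw : ∀ m, π (wGen m) = σ (wGen m)) : π = σ := by
  have c : ∀ τ : TCov →⋆ₐ[ℂ] C, Continuous τ := fun τ =>
    AddMonoidHomClass.continuous_of_bound τ 1 fun x => by
      rw [one_mul]
      exact NonUnitalStarAlgHom.norm_apply_le τ x
  refine StarAlgHom.ext fun x => ?_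
  have hx : x ∈ (StarAlgebra.adjoin ℂ (insert uGen (Set.range wGen))).topologicalClosure := by
    rw [topologicalClosure_adjoin_gen]
    trivial
  refine closure_minimal (fun y hy => ?_) (isClosed_eq (c π) (c σ)) hx
  induction hy using StarAlgebra.adjoin_induction with
  | mem y hy =>
    rcases hy with rfl | ⟨m, rfl⟩
    exacts [hu, hw m]
  | algebraMap c => exact (AlgHomClass.commutes π c).trans (AlgHomClass.commutes σ c).symm
  | add x y _ _ hx hy =>
    change π (x + y) = σ (x + y)
    rw [map_add, map_add]
    exact congrArg₂ _ hx hy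
  | mul x y _ _ hx hy =>
    change π (x * y) = σ (x * y)
    rw [_root_.map_mul, _root_.map_mul]
    exact congrArg₂ _ hx hy
  | star x _ hx =>
    change π (star x) = σ (star x)
    rw [map_star, map_star]
    exact congrArg star hx

theorem Relations.exists_hom {U : C} {W : ℕ+ → C} (h : Relations U W) :
    ∃ π : TCov →⋆ₐ[ℂ] C, π uGen = U ∧ ∀ m : ℕ+, π (wGen m) = W m := by
  obtain ⟨π, hπ, -⟩ := exists_unique_lift h.rep h.rep_isNicaCovariant
  have key : ∀ (m : ℕ+) (ξ : Fib m), π (univRep.toFun m ξ) = h.rho ξ.fn * W m := by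
    intro m ξ
    rw [← h.rep_toFun, ← hπ]
    rfl
  -- The lift is only a non-unital homomorphism a priori; it is unital because the unit is `i_1(1)`
  -- and `W 1 = 1`.
  have h1 : π 1 = 1 := by
    have := key 1 ⟨1⟩
    rw [map_one, h.w_one, mul_one] at this
    exact this
  refine ⟨{ π with
    map_one' := h1
    commutes' := fun c => ?_ }, ?_, fun m => ?_⟩
  · change π _ = _
    rw [Algebra.algebraMap_eq_smul_one, Algebra.algebraMap_eq_smul_one, map_smul, h1]
  · refine (key 1 ⟨Z⟩).trans ?_
    rw [h.rho_Z, h.w_one, mul_one]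
  · refine (key m ⟨1⟩).trans ?_
    rw [map_one, one_mul]

end

end NicaToeplitz

theorem theorem3p2 :
    NicaToeplitz.Relations NicaToeplitz.uGen NicaToeplitz.wGen ∧
    (StarAlgebra.adjoin ℂ
      (insert NicaToeplitz.uGen (Set.range NicaToeplitz.wGen))).topologicalClosure = ⊤ ∧
    ∀ (C : Type*) [CStarAlgebra C] (U : C) (W : ℕ+ → C), NicaToeplitz.Relations U W →
      ∃! π : NicaToeplitz.TCov →⋆ₐ[ℂ] C,
        π NicaToeplitz.uGen = U ∧ ∀ m : ℕ+, π (NicaToeplitz.wGen m) = W m := by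
  refine ⟨NicaToeplitz.relations_gen, NicaToeplitz.topologicalClosure_adjoin_gen, ?_⟩
  intro C _ U W h
  obtain ⟨π, hu, hw⟩ := h.exists_hom
  refine ⟨π, ⟨hu, hw⟩, fun σ hσ => ?_⟩
  exact NicaToeplitz.starAlgHom_ext_gen (hσ.1.trans hu.symm) fun m => (hσ.2 m).trans (hw m).symm
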